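/- **Weighted approximate monotone local search.** An instance of weighted monotone subset minimization is a triple $(U,w,\mathcal F)$, where $U$ is a finite set, $w\colon U\to\mathbb N$ is a weight function, and $\mathcal F\subseteq 2^U$ satisfies $U\in\mathcal F$ and is closed under supersets. Write $n=|U|$, $w(S)=\sum_{e\in S}w(e)$ and $\mathrm{opt}(U,w,\mathcal F)=\min\{w(S): S\in\mathcal F\}$. For $\alpha\ge 1$, an $\alpha$-extension oracle of $(U,w,\mathcal F)$ is a function $O\colon 2^U\times\mathbb Z_{\ge 0}\to 2^U$ such that for all $S\subseteq U$ and $\ell\ge 0$ $$O(S,\ell)\cup S\in\mathcal F,\qquad w(O(S,\ell))\le \alpha\cdot\min\{w(X): X\subseteq U,\ |X|\le\ell,\ X\cup S\in\mathcal F\}\quad(\min\emptyset=\infty).$$ In the $(\alpha,c)$-extension model an algorithm receives $U=\{0,\dots,n-1\}$ and $w$ as input and can access $\mathcal F$ only by querying an $\alpha$-extension oracle of $(U,w,\mathcal F)$. Its running time is the number of its computation steps plus $c^{\ell}$ for every query $(S,\ell)$ it issues; computation steps are those of a random access machine with unit-cost addition, truncated subtraction and comparison of natural numbers. It is a $\beta$-approximation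 algorithm if for every instance and every $\alpha$-extension oracle of it the algorithm halts and returns some $T\in\mathcal F$ with $w(T)\le\beta\cdot\mathrm{opt}(U,w,\mathcal F)$; it runs in time $f(n)$ if its running time is at most $f(|U|)$ for every instance and every $\alpha$-extension oracle of it. Let $\mathcal H(x)=-x\ln x-(1-x)\ln(1-x)$ with $\mathcal H(0)=\mathcal H(1)=0$. For $\alpha,c\ge 1$, $\beta>1$ put $$\delta(\kappa,\tau)=\begin{cases}\frac{\beta\kappa-\tau}{\alpha(1-\tau)}&\tau\ne1\\ \frac1\alpha&\tau=1\end{cases},\qquad \gamma(\kappa,\tau)=\begin{cases}\left(1-\frac\beta\alpha\right)\frac\kappa\tau+\frac1\alpha&\tau\neq0\\ \frac1\alpha&\tau=0\end{cases},\qquad M(\kappa)=\begin{cases}\frac{\beta-\alpha}{1-\alpha\kappa}\,\kappa&\alpha<\beta\\ 0&\alpha=\beta\\ \frac{\alpha-\beta}{\alpha-1}\,\kappa&\alpha>\beta\end{cases},$$ $$g(\kappa,\tau)=\tfrac{\beta\kappa-\tau}{\alpha}\ln c-\tau\,\mathcal H(\gamma(\kappa,\tau))-(1-\tau)\,\mathcal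 H(\delta(\kappa,\tau))+\mathcal H(\kappa),$$ $$\mathrm{amls}(\alpha,c,\beta)=\exp\Bigl(\max_{0\le\kappa\le1/\beta}\ \min_{M(\kappa)\le\tau\le\beta\kappa}g(\kappa,\tau)\Bigr).$$ **Theorem.** For all real $\alpha,c\ge1$, $\beta>1$ and $\varepsilon>0$ there is a deterministic $\beta$-approximation algorithm for weighted monotone subset minimization in the $(\alpha,c)$-extension model which runs in time $O\bigl((\mathrm{amls}(\alpha,c,\beta)+\varepsilon)^n\bigr)$. -/

import Mathlib

/-! ### Weighted monotone subset minimization -/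

namespace WSM

/-- The total weight `w(S) = ∑ e ∈ S, w e`. -/
def weight {n : ℕ} (w : Fin n → ℕ) (S : Finset (Fin n)) : ℕ := ∑ e ∈ S, w e

/-- A set system of `U = {0, …, n-1}` is monotone if it contains `U` and is closed under
supersets. -/
structure IsMonotone {n : ℕ} (F : Set (Finset (Fin n))) : Prop where
  univ_mem : Finset.univ ∈ F
  mem_of_subset : ∀ T S : Finset (Fin n), T ⊆ S → T ∈ F → S ∈ F

/-- The optimum value `min {w(S) | S ∈ F}`; the minimum is over a nonempty set of natural
numbers whenever `F` is monotone. -/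
noncomputable def opt {n : ℕ} (w : Fin n → ℕ) (F : Set (Finset (Fin n))) : ℕ :=
  sInf (weight w '' F)

/-- `O` is an `α`-extension oracle for the instance `(U, w, F)`: the answer to the query `(S, ℓ)`
extends `S` to a member of `F`, and its weight is at most `α` times the minimum weight of an
extension of `S` with at most `ℓ` elements (no condition if there is no such extension). -/
structure IsExtensionOracle {n : ℕ} (α : ℝ) (w : Fin n → ℕ) (F : Set (Finset (Fin n)))
    (O : Finset (Fin n) → ℕ → Finset (Fin n)) : Prop where
  union_mem : ∀ S ℓ, O S ℓ ∪ S ∈ F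
  weight_le : ∀ S ℓ, ∀ X : Finset (Fin n), X.card ≤ ℓ → X ∪ S ∈ F →
    (weight w (O S ℓ) : ℝ) ≤ α * weight w X

/-! ### The machine model

A deterministic random access machine with unit-cost addition, truncated subtraction and
comparison of natural numbers, programmed in a structured language.  There are no
multiplications, divisions or bit operations.  The memory consists of registers and of arrays
that are addressed indirectly; a program mentions only finitely many of them. -/

/-- The memory of the machine: `reg x` is register `x`, and `arr a i` is cell `i` of array `a`. -/
structure State where
  reg : ℕ → ℕ
  arr : ℕ → ℕ → ℕ

/-- Arithmetic expressions. -/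
inductive Expr where
  /-- a constant of the program -/
  | const (k : ℕ)
  /-- the content of register `x` -/
  | reg (x : ℕ)
  /-- the content of the cell of array `a` whose index is the value of `i` -/
  | arr (a : ℕ) (i : Expr)
  /-- addition -/
  | add (e₁ e₂ : Expr)
  /-- truncated subtraction -/
  | sub (e₁ e₂ : Expr)

/-- The value of an expression. -/
def Expr.eval (σ : State) : Expr → ℕ
  | .const k => k
  | .reg x => σ.reg x
  | .arr a i => σ.arr a (i.eval σ)
  | .add e₁ e₂ => e₁.eval σ + e₂.eval σ
  | .sub e₁ e₂ => e₁.eval σ - e₂.eval σ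

/-- The number of steps needed to evaluate an expression: one for each of its nodes. -/
def Expr.steps : Expr → ℕ
  | .const _ => 1
  | .reg _ => 1
  | .arr _ i => i.steps + 1
  | .add e₁ e₂ => e₁.steps + e₂.steps + 1
  | .sub e₁ e₂ => e₁.steps + e₂.steps + 1

/-- Programs. -/
inductive Program where
  /-- do nothing -/
  | skip
  /-- write the value of `e` into register `x` -/
  | assign (x : ℕ) (e : Expr)
  /-- write the value of `e` into the cell of array `a` whose index is the value of `i` -/
  | store (a : ℕ) (i e : Expr)
  /-- query the oracle on the set stored in array `s` and on the value of `ℓ`, and store the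
  answer in array `x` -/
  | query (s : ℕ) (ℓ : Expr) (x : ℕ)
  /-- run `P`, then `Q` -/
  | seq (P Q : Program)
  /-- run `P` if the value of `e` is not zero, and `Q` otherwise -/
  | ite (e : Expr) (P Q : Program)
  /-- as long as the value of `e` is not zero, run `P` -/
  | loop (e : Expr) (P : Program)

/-- Overwrite register `x`. -/
def State.setReg (σ : State) (x v : ℕ) : State :=
  { σ with reg := Function.update σ.reg x v }

/-- Overwrite cell `i` of array `a`. -/
def State.setCell (σ : State) (a i v : ℕ) : State :=
  { σ with arr := Function.update σ.arr a (Function.update (σ.arr a) i v) }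

/-- The subset of `{0, …, n-1}` stored in array `a`: the indices of its nonzero cells. -/
def State.getSet (n : ℕ) (σ : State) (a : ℕ) : Finset (Fin n) :=
  Finset.univ.filter fun i => σ.arr a i ≠ 0

/-- Overwrite the first `n` cells of array `a` by the characteristic vector of `X`. -/
def State.setSet {n : ℕ} (σ : State) (a : ℕ) (X : Finset (Fin n)) : State :=
  { σ with arr := Function.update σ.arr a fun i =>
      if h : i < n then (if (⟨i, h⟩ : Fin n) ∈ X then 1 else 0) else σ.arr a i }

/-- `Exec O c P σ σ' t`: with oracle `O`, the program `P` started in state `σ` halts in state `σ'`,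
and its running time is `t`, where every query `(S, ℓ)` contributes `c ^ ℓ` in addition to the
computation steps. -/
inductive Exec {n : ℕ} (O : Finset (Fin n) → ℕ → Finset (Fin n)) (c : ℝ) :
    Program → State → State → ℝ → Prop where
  | skip (σ : State) : Exec O c .skip σ σ 1
  | assign (σ : State) (x : ℕ) (e : Expr) :
      Exec O c (.assign x e) σ (σ.setReg x (e.eval σ)) (e.steps + 1)
  | store (σ : State) (a : ℕ) (i e : Expr) :
      Exec O c (.store a i e) σ (σ.setCell a (i.eval σ) (e.eval σ)) (i.steps + e.steps + 1)
  | query (σ : State) (s : ℕ) (ℓ : Expr) (x : ℕ) :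
      Exec O c (.query s ℓ x) σ (σ.setSet x (O (σ.getSet n s) (ℓ.eval σ)))
        (ℓ.steps + 1 + c ^ ℓ.eval σ)
  | seq {P Q : Program} {σ₁ σ₂ σ₃ : State} {t₁ t₂ : ℝ} :
      Exec O c P σ₁ σ₂ t₁ → Exec O c Q σ₂ σ₃ t₂ → Exec O c (.seq P Q) σ₁ σ₃ (t₁ + t₂)
  | ite_true {e : Expr} {P Q : Program} {σ σ' : State} {t : ℝ} :
      e.eval σ ≠ 0 → Exec O c P σ σ' t → Exec O c (.ite e P Q) σ σ' (e.steps + 1 + t)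
  | ite_false {e : Expr} {P Q : Program} {σ σ' : State} {t : ℝ} :
      e.eval σ = 0 → Exec O c Q σ σ' t → Exec O c (.ite e P Q) σ σ' (e.steps + 1 + t)
  | loop_true {e : Expr} {P : Program} {σ₁ σ₂ σ₃ : State} {t₁ t₂ : ℝ} :
      e.eval σ₁ ≠ 0 → Exec O c P σ₁ σ₂ t₁ → Exec O c (.loop e P) σ₂ σ₃ t₂ →
      Exec O c (.loop e P) σ₁ σ₃ (e.steps + 1 + t₁ + t₂)
  | loop_false {e : Expr} {P : Program} {σ : State} :
      e.eval σ = 0 → Exec O c (.loop e P) σ σ (e.steps + 1)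

/-- The machine is deterministic: the final state and the running time are unique. -/
theorem Exec.unique {n : ℕ} {O : Finset (Fin n) → ℕ → Finset (Fin n)} {c : ℝ} {P : Program}
    {σ σ₁ σ₂ : State} {t₁ t₂ : ℝ} (h₁ : Exec O c P σ σ₁ t₁) (h₂ : Exec O c P σ σ₂ t₂) :
    σ₁ = σ₂ ∧ t₁ = t₂ := by
  induction h₁ generalizing σ₂ t₂ with
  | skip => cases h₂; exact ⟨rfl, rfl⟩
  | assign => cases h₂; exact ⟨rfl, rfl⟩
  | store => cases h₂; exact ⟨rfl, rfl⟩
  | query => cases h₂; exact ⟨rfl, rfl⟩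
  | seq _ _ ih₁ ih₂ =>
    cases h₂ with
    | seq a b =>
      obtain ⟨rfl, rfl⟩ := ih₁ a
      obtain ⟨rfl, rfl⟩ := ih₂ b
      exact ⟨rfl, rfl⟩
  | ite_true h _ ih =>
    cases h₂ with
    | ite_true _ a => obtain ⟨rfl, rfl⟩ := ih a; exact ⟨rfl, rfl⟩
    | ite_false h' _ => exact absurd h' h
  | ite_false h _ ih =>
    cases h₂ with
    | ite_true h' _ => exact absurd h h'
    | ite_false _ a => obtain ⟨rfl, rfl⟩ := ih a; exact ⟨rfl, rfl⟩
  | loop_true h _ _ ih₁ ih₂ =>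
    cases h₂ with
    | loop_true _ a b =>
      obtain ⟨rfl, rfl⟩ := ih₁ a
      obtain ⟨rfl, rfl⟩ := ih₂ b
      exact ⟨rfl, rfl⟩
    | loop_false h' => exact absurd h' h
  | loop_false h =>
    cases h₂ with
    | loop_true h' _ _ => exact absurd h h'
    | loop_false _ => exact ⟨rfl, rfl⟩

/-- The initial state on input `(U, w)` with `U = {0, …, n-1}`: register `0` holds `n`, array `0`
holds the weights, and everything else is zero. -/
def input {n : ℕ} (w : Fin n → ℕ) : State where
  reg := fun x => if x = 0 then n else 0
  arr := fun a i => if h : a = 0 ∧ i < n then w ⟨i, h.2⟩ else 0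

/-- The set returned by the program: it is read off array `1` of the final state. -/
def output (n : ℕ) (σ : State) : Finset (Fin n) := σ.getSet n 1

/-- `P` is a (deterministic) `β`-approximation algorithm for weighted monotone subset minimization
in the `(α, c)`-extension model: on every instance and for every `α`-extension oracle of the
instance it halts and returns `T ∈ F` with `w(T) ≤ β * opt`. -/
def IsApproximation (α c β : ℝ) (P : Program) : Prop :=
  ∀ (n : ℕ) (w : Fin n → ℕ) (F : Set (Finset (Fin n))), IsMonotone F →
    ∀ O : Finset (Fin n) → ℕ → Finset (Fin n), IsExtensionOracle α w F O →
      ∃ (σ : State) (t : ℝ), Exec O c P (input w) σ t ∧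
        output n σ ∈ F ∧ (weight w (output n σ) : ℝ) ≤ β * opt w F

/-- `P` runs in time `f(n)` in the `(α, c)`-extension model: on every instance with `n` elements
and for every `α`-extension oracle of the instance, its running time is at most `f n`. -/
def RunsInTime (α c : ℝ) (P : Program) (f : ℕ → ℝ) : Prop :=
  ∀ (n : ℕ) (w : Fin n → ℕ) (F : Set (Finset (Fin n))), IsMonotone F →
    ∀ O : Finset (Fin n) → ℕ → Finset (Fin n), IsExtensionOracle α w F O →
      ∃ (σ : State) (t : ℝ), Exec O c P (input w) σ t ∧ t ≤ f n

/-! ### The function `amls`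

`Real.binEntropy x = - x ln x - (1 - x) ln (1 - x)`, with value `0` at `0` and `1`. -/

/-- The auxiliary function `δ_{α,β}(κ,τ)`. -/
noncomputable def amlsDelta (α β κ τ : ℝ) : ℝ :=
  if τ = 1 then 1 / α else (β / α * κ - τ / α) / (1 - τ)

/-- The auxiliary function `γ_{α,β}(κ,τ)`. -/
noncomputable def amlsGamma (α β κ τ : ℝ) : ℝ :=
  if τ = 0 then 1 / α else (1 - β / α) * (κ / τ) + 1 / α

/-- The objective function `g_{α,β,c}(κ,τ)`. -/
noncomputable def amlsG (α β c κ τ : ℝ) : ℝ :=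
  (β * κ - τ) / α * Real.log c - τ * Real.binEntropy (amlsGamma α β κ τ)
    - (1 - τ) * Real.binEntropy (amlsDelta α β κ τ) + Real.binEntropy κ

/-- The lower end `M_{α,β}(κ)` of the range of `τ`. -/
noncomputable def amlsM (α β κ : ℝ) : ℝ :=
  if α < β then (β - α) / (1 - α * κ) * κ
  else if α = β then 0
  else (α - β) / (α - 1) * κ

/-- `amls(α,c,β) = exp (max_{0 ≤ κ ≤ 1/β} min_{M(κ) ≤ τ ≤ βκ} g(κ,τ))`.  For `α, c ≥ 1` and `β > 1`
the ranges of `κ` and `τ` are nonempty, and `g` is bounded on them. -/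
noncomputable def amls (α c β : ℝ) : ℝ :=
  Real.exp (sSup ((fun κ : ℝ =>
    sInf (amlsG α β c κ '' Set.Icc (amlsM α β κ) (β * κ))) '' Set.Icc 0 (1 / β)))

end WSM

/-! ### Bounds for factorials -/

namespace WSM

open Real Finset

/-! Sort the elements by decreasing weight and let `R` be the set of positions of an optimal
solution. Fix a constant block size `B`. The first positions, up to a point `s` where `B` elements
of `R` have been seen, are guessed exactly; this costs only polynomially many guesses. The remaining
positions are cut into blocks of `B` consecutive positions. In each block one tries every entry `(S,
ℓ)` of a fixed finite family such that every `K ⊆ range B` has an entry with `|K \ S| ≤ ℓ` and `|S|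
+ α |K \ S| ≤ β |K|`. The oracle is asked to extend the union of all chosen sets by the sum of the
sizes `ℓ`.

Cardinalities replace weights at a small price. Inside a block the weights lie between `W a` and `W
(a + B)`, so the error is at most `(β - 1) B (W a - W (a + B))` (`sum_block_le`). These errors
telescope to at most `(β - 1) B W s`, which is what was saved on the `B` exactly guessed elements,
each of weight at least `W s` (`exists_good_positions`).

The family comes from a covering argument. A random set of `x + z` elements meets a fixed set of `x
+ y` elements in exactly `x` elements with a hypergeometric probability `p`; greedily about `B / p`
sets suffice (`exists_cover_list`), each with query cost `c ^ y`. By Stirling bounds the logarithm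
of the cost divided by `B` is `rate`, up to a term that tends to zero. For `y = (β κ - τ) / α`, the
largest relative query size that the weight condition allows, `rate` is the function `g`
(`amlsG_eq_rate`). Rounding and the choice of a large `B` give total cost at most `(amls + ε) ^ B`
(`exists_covering_family`).

The query costs of all combinations of entries sum to the `N`-th power of the cost of the family,
where `N = ⌈n / B⌉` (`sum_pow_blockSize`). The rest verifies a program which enumerates the guesses
with polynomial overhead. -/

theorem mul_log_sub_le_log_factorial (m : ℕ) :
    (m : ℝ) * log m - m ≤ log (m.factorial : ℝ) := by
  rcases Nat.eq_zero_or_pos m with rfl | hm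
  · simp
  have h := Real.pow_div_factorial_le_exp (m : ℝ) (Nat.cast_nonneg m) m
  have hf : (0 : ℝ) < m.factorial := by exact_mod_cast m.factorial_pos
  have hm' : (0 : ℝ) < m := by exact_mod_cast hm
  rw [div_le_iff₀ hf] at h
  have := Real.log_le_log (by positivity) h
  rw [Real.log_pow, Real.log_mul (exp_pos _).ne' hf.ne', Real.log_exp] at this
  linarith

theorem log_factorial_le_succ (m : ℕ) :
    log (m.factorial : ℝ) ≤ ((m : ℝ) + 1) * log (m + 1) - m := by
  induction m with
  | zero => simp
  | succ m ih =>
    have hf : (0 : ℝ) < m.factorial := by exact_mod_cast m.factorial_pos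
    have hm : (0 : ℝ) < (m : ℝ) + 1 := by positivity
    have hm2 : (0 : ℝ) < (m : ℝ) + 2 := by positivity
    rw [Nat.factorial_succ]
    push_cast
    rw [Real.log_mul hm.ne' hf.ne']
    have h := Real.one_sub_inv_le_log_of_pos (div_pos hm2 hm)
    rw [Real.log_div hm2.ne' hm.ne', inv_div] at h
    have h2 : ((m : ℝ) + 2) * (1 - (m + 1) / (m + 2)) = 1 := by field_simp; ring
    have h3 := mul_le_mul_of_nonneg_left h hm2.le
    rw [h2] at h3
    have e : (m : ℝ) + 1 + 1 = m + 2 := by ring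
    rw [e]
    nlinarith

/-- Passing from `m + 1` to `m` in the previous bound uses `m log ((m + 1) / m) ≤ 1`. A logarithmic
error is good enough: it contributes a factor polynomial in `B`, which a large `B` absorbs. -/
theorem log_factorial_le (m : ℕ) :
    log (m.factorial : ℝ) ≤ (m : ℝ) * log m - m + (log (m + 1) + 1) := by
  refine (log_factorial_le_succ m).trans ?_
  rcases Nat.eq_zero_or_pos m with rfl | hm
  · simp
  have hm' : (0 : ℝ) < m := by exact_mod_cast hm
  have hm1 : (0 : ℝ) < (m : ℝ) + 1 := by positivity
  have h := Real.log_le_sub_one_of_pos (div_pos hm1 hm')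
  rw [Real.log_div hm1.ne' hm'.ne'] at h
  have h3 := mul_le_mul_of_nonneg_left h hm'.le
  have h2 : (m : ℝ) * ((m + 1) / m - 1) = 1 := by field_simp; ring
  rw [h2] at h3
  nlinarith

/-! ### Greedy covering -/

/-- If every `K ∈ 𝒦` is hit by at least a `p`-fraction of `𝒮`, then `m` greedily chosen elements
of `𝒮` leave at most a `(1 - p) ^ m`-fraction of `𝒦` unhit. -/
theorem exists_greedy_cover {ι κ : Type*} (𝒮 : Finset ι) (𝒦 : Finset κ)
    (R : ι → κ → Prop) [∀ s k, Decidable (R s k)] (p : ℝ) (hp1 : p ≤ 1)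
    (hS : 𝒮.Nonempty)
    (h : ∀ k ∈ 𝒦, p * #𝒮 ≤ #(𝒮.filter fun s => R s k)) (m : ℕ) :
    ∃ L : List ι, L.length = m ∧ (∀ s ∈ L, s ∈ 𝒮) ∧
      (#(𝒦.filter fun k => ∀ s ∈ L, ¬ R s k) : ℝ) ≤ (1 - p) ^ m * #𝒦 := by
  induction m with
  | zero => exact ⟨[], by simp⟩
  | succ m ih =>
    obtain ⟨L, hL, hLS, hcard⟩ := ih
    set U := 𝒦.filter fun k => ∀ s ∈ L, ¬ R s k with hU
    -- Double counting of pairs: on average an element of `𝒮` hits at least `p * #U` of the unhit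
    -- ones, so some element does.
    have hsum : ∑ _s ∈ 𝒮, p * #U ≤ ∑ s ∈ 𝒮, (#(U.filter fun k => R s k) : ℝ) := by
      have e : ∑ s ∈ 𝒮, (#(U.filter fun k => R s k) : ℝ)
          = ∑ k ∈ U, (#(𝒮.filter fun s => R s k) : ℝ) := by
        simp only [Finset.card_filter, Nat.cast_sum]
        exact Finset.sum_comm
      rw [e, Finset.sum_const, nsmul_eq_mul]
      have : ∑ _k ∈ U, p * #𝒮 ≤ ∑ k ∈ U, (#(𝒮.filter fun s => R s k) : ℝ) :=
        Finset.sum_le_sum fun k hk => h k (Finset.mem_filter.1 hk).1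
      rw [Finset.sum_const, nsmul_eq_mul] at this
      nlinarith
    obtain ⟨s, hs, hle⟩ := Finset.exists_le_of_sum_le hS hsum
    refine ⟨s :: L, by simp [hL], ?_, ?_⟩
    · simpa [hs] using hLS
    have hsplit : #(U.filter fun k => R s k) + #(U.filter fun k => ¬ R s k) = #U :=
      Finset.card_filter_add_card_filter_not _
    have heq : (𝒦.filter fun k => ∀ s' ∈ s :: L, ¬ R s' k) = U.filter fun k => ¬ R s k := by
      ext k; simp [hU]; tauto
    rw [heq]
    have hsplit' : (#(U.filter fun k => R s k) : ℝ) + #(U.filter fun k => ¬ R s k) = #U := by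
      exact_mod_cast hsplit
    calc (#(U.filter fun k => ¬ R s k) : ℝ) ≤ (1 - p) * #U := by linarith
      _ ≤ (1 - p) * ((1 - p) ^ m * #𝒦) := mul_le_mul_of_nonneg_left hcard (by linarith)
      _ = _ := by ring

/-- After `m = ⌊B / p⌋ + 1` greedy rounds the unhit part has size at most `(1 - p) ^ m * #𝒦 ≤ exp
(-p m) * 2 ^ B < 1`, hence is empty. -/
theorem exists_cover_list {ι κ : Type*} (𝒮 : Finset ι) (𝒦 : Finset κ)
    (R : ι → κ → Prop) [∀ s k, Decidable (R s k)] (p : ℝ) (hp0 : 0 < p) (hp1 : p ≤ 1)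
    (hS : 𝒮.Nonempty)
    (h : ∀ k ∈ 𝒦, p * #𝒮 ≤ #(𝒮.filter fun s => R s k)) (B : ℕ) (hB : #𝒦 ≤ 2 ^ B) :
    ∃ L : List ι, (L.length : ℝ) ≤ (B + 1) / p ∧ (∀ s ∈ L, s ∈ 𝒮) ∧
      ∀ k ∈ 𝒦, ∃ s ∈ L, R s k := by
  obtain ⟨L, hL, hLS, hc⟩ := exists_greedy_cover 𝒮 𝒦 R p hp1 hS h (⌊B / p⌋₊ + 1)
  refine ⟨L, ?_, hLS, ?_⟩
  · rw [hL]
    push_cast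
    have h1 := Nat.floor_le (show (0 : ℝ) ≤ B / p by positivity)
    have h2 : 1 ≤ 1 / p := by rw [le_div_iff₀ hp0]; linarith
    rw [add_div]; linarith
  · have hlt : (#(𝒦.filter fun k => ∀ s ∈ L, ¬ R s k) : ℝ) < 1 := by
      refine hc.trans_lt ?_
      have h1 : (1 - p) ^ (⌊B / p⌋₊ + 1) ≤ exp (-p) ^ (⌊B / p⌋₊ + 1) :=
        pow_le_pow_left₀ (by linarith) (by linarith [Real.add_one_le_exp (-p)]) _
      have h2 : exp (-p) ^ (⌊B / p⌋₊ + 1) < exp (-B) := by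
        rw [← Real.exp_nat_mul]
        apply Real.exp_lt_exp.2
        have := Nat.lt_floor_add_one ((B : ℝ) / p)
        rw [div_lt_iff₀ hp0] at this
        push_cast
        linarith
      have h3 : (#𝒦 : ℝ) ≤ exp B := by
        have : (#𝒦 : ℝ) ≤ 2 ^ B := by exact_mod_cast hB
        refine this.trans ?_
        rw [← mul_one (B : ℝ), Real.exp_nat_mul]
        exact pow_le_pow_left₀ (by norm_num) (by linarith [Real.add_one_le_exp (1 : ℝ)]) _
      rcases Nat.eq_zero_or_pos #𝒦 with h0 | h0
      · simp [h0]
      calc (1 - p) ^ (⌊B / p⌋₊ + 1) * #𝒦 < exp (-B) * #𝒦 :=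
            mul_lt_mul_of_pos_right (h1.trans_lt h2) (by exact_mod_cast h0)
        _ ≤ exp (-B) * exp B := mul_le_mul_of_nonneg_left h3 (exp_pos _).le
        _ = 1 := by rw [← Real.exp_add]; simp
    have h0 : #(𝒦.filter fun k => ∀ s ∈ L, ¬ R s k) = 0 := by
      have : #(𝒦.filter fun k => ∀ s ∈ L, ¬ R s k) < 1 := by exact_mod_cast hlt
      omega
    rw [Finset.card_eq_zero, Finset.filter_eq_empty_iff] at h0
    intro k hk
    have := h0 hk
    push Not at this
    exact this

/-- The number of `(x + z)`-subsets of `U` which meet `K` in exactly `x` elements. -/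
theorem card_filter_card_inter {U K : Finset ℕ} (hK : K ⊆ U) (x z : ℕ) :
    (#K).choose x * (#U - #K).choose z
      ≤ #((U.powersetCard (x + z)).filter fun S => #(S ∩ K) = x) := by
  rw [← Finset.card_sdiff_of_subset hK, ← Finset.card_powersetCard, ← Finset.card_powersetCard,
    ← Finset.card_product]
  -- Only this inequality is needed. The union determines both parts: they are its intersection with
  -- `K` and its difference from `K`.
  refine Finset.card_le_card_of_injOn (fun P => P.1 ∪ P.2) ?_ ?_
  · rintro ⟨A, C⟩ h
    simp only [Finset.coe_product, Set.mem_prod, Finset.mem_coe, Finset.mem_powersetCard] at h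
    obtain ⟨⟨hA, hAx⟩, hC, hCz⟩ := h
    have hd : Disjoint A C := by
      rw [Finset.disjoint_left]; intro a ha hc
      exact (Finset.mem_sdiff.1 (hC hc)).2 (hA ha)
    simp only [Finset.coe_filter, Finset.mem_powersetCard, Set.mem_ofPred_eq]
    refine ⟨⟨Finset.union_subset (hA.trans hK) (hC.trans Finset.sdiff_subset), ?_⟩, ?_⟩
    · rw [Finset.card_union_of_disjoint hd, hAx, hCz]
    · rw [← hAx]; congr 1; ext a
      simp only [Finset.mem_inter, Finset.mem_union]
      constructor
      · rintro ⟨h | h, hk⟩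
        · exact h
        · exact absurd hk (Finset.mem_sdiff.1 (hC h)).2
      · exact fun h => ⟨Or.inl h, hA h⟩
  · rintro ⟨A, C⟩ h ⟨A', C'⟩ h' heq
    simp only [Finset.coe_product, Set.mem_prod, Finset.mem_coe, Finset.mem_powersetCard] at h h'
    simp only at heq
    have key : ∀ {A C : Finset ℕ}, A ⊆ K → C ⊆ U \ K → (A ∪ C) ∩ K = A ∧ (A ∪ C) \ K = C := by
      intro A C hA hC
      constructor <;> ext a <;> have h1 := @hA a <;> have h2 := @hC a <;>
        simp only [Finset.mem_inter, Finset.mem_sdiff, Finset.mem_union] at * <;> tauto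
    have h1 := key h.1.1 h.2.1
    have h2 := key h'.1.1 h'.2.1
    rw [heq] at h1
    exact Prod.ext (h1.1.symm.trans h2.1) (h1.2.symm.trans h2.2)

end WSM

namespace WSM

open Real Finset

/-! ### The exponential rate of a covering -/

/-- The objective function in terms of `κ`, `τ` and the relative query size `y`. -/
noncomputable def rate (c κ τ y : ℝ) : ℝ :=
  y * log c + negMulLog κ + negMulLog (1 - κ) + negMulLog τ + negMulLog (1 - τ)
    - negMulLog (κ - y) - negMulLog (τ - κ + y) - negMulLog y - negMulLog (1 - τ - y)

/-- Rescales `a log a` to the proportion `a / b`; in a balanced sum of such terms the parts `a log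
b` cancel and only entropies remain. -/
theorem natCast_mul_log_eq (a : ℕ) {b : ℝ} (hb : 0 < b) :
    (a : ℝ) * log a = a * log b - b * negMulLog (a / b) := by
  rcases Nat.eq_zero_or_pos a with rfl | ha
  · simp
  have ha' : (0 : ℝ) < a := by exact_mod_cast ha
  rw [negMulLog, Real.log_div ha'.ne' hb.ne']
  field_simp
  ring

/-- The inverse of the probability that a random `(x + z)`-subset of a set with `x + y + z + r`
elements meets a fixed `(x + y)`-subset in exactly `x` elements. -/
theorem log_inv_hypergeometric_le (x y z r : ℕ) (hB : 0 < x + y + z + r) :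
    log (((x + y + z + r).choose (x + z) : ℝ) / ((x + y).choose x * (z + r).choose z))
      ≤ (x + y + z + r : ℕ) * rate 1 ((x + y : ℕ) / (x + y + z + r : ℕ))
          ((x + z : ℕ) / (x + y + z + r : ℕ)) (y / (x + y + z + r : ℕ))
        + 5 * (log ((x + y + z + r : ℕ) + 1) + 1) := by
  set B := x + y + z + r with hBdef
  have hb : (0 : ℝ) < (B : ℝ) := by exact_mod_cast hB
  have fp : ∀ m : ℕ, (m.factorial : ℝ) ≠ 0 := fun m => by exact_mod_cast m.factorial_ne_zero
  have c1 : (B.choose (x + z) : ℝ) = B.factorial / ((x + z).factorial * (y + r).factorial) := by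
    rw [show B = (x + z) + (y + r) by omega, Nat.cast_add_choose]
  have c2 : ((x + y).choose x : ℝ) = (x + y).factorial / (x.factorial * y.factorial) :=
    Nat.cast_add_choose ℝ
  have c3 : ((z + r).choose z : ℝ) = (z + r).factorial / (z.factorial * r.factorial) :=
    Nat.cast_add_choose ℝ
  have hlog : log ((B.choose (x + z) : ℝ) / ((x + y).choose x * (z + r).choose z))
      = log (B.factorial : ℝ) - log ((x + z).factorial : ℝ) - log ((y + r).factorial : ℝ)
        - log ((x + y).factorial : ℝ) + log (x.factorial : ℝ) + log (y.factorial : ℝ)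
        - log ((z + r).factorial : ℝ) + log (z.factorial : ℝ) + log (r.factorial : ℝ) := by
    rw [c1, c2, c3]
    have h1 := fp B
    have h2 := fp (x + z)
    have h3 := fp (y + r)
    have h4 := fp (x + y)
    have h5 := fp x
    have h6 := fp y
    have h7 := fp (z + r)
    have h8 := fp z
    have h9 := fp r
    rw [Real.log_div (by positivity) (by positivity), Real.log_mul (by positivity) (by positivity),
      Real.log_div h1 (by positivity), Real.log_div h4 (by positivity),
      Real.log_div h7 (by positivity), Real.log_mul h2 h3, Real.log_mul h5 h6, Real.log_mul h8 h9]
    ring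
  rw [hlog]
  have mono : ∀ a : ℕ, a ≤ B → log ((a : ℝ) + 1) ≤ log ((B : ℝ) + 1) := fun a ha =>
    Real.log_le_log (by positivity) (by have : (a : ℝ) ≤ B := by exact_mod_cast ha
                                        linarith)
  -- Five factorials enter with a positive sign and need the upper bound, which has an error; the
  -- four negative ones use the lower bound, which has none. Hence the factor `5`.
  have u1 := log_factorial_le B
  have u2 := log_factorial_le x
  have u3 := log_factorial_le y
  have u4 := log_factorial_le z
  have u5 := log_factorial_le r
  have m2 := mono x (by omega)
  have m3 := mono y (by omega)
  have m4 := mono z (by omega)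
  have m5 := mono r (by omega)
  have l1 := mul_log_sub_le_log_factorial (x + z)
  have l2 := mul_log_sub_le_log_factorial (y + r)
  have l3 := mul_log_sub_le_log_factorial (x + y)
  have l4 := mul_log_sub_le_log_factorial (z + r)
  rw [natCast_mul_log_eq _ hb] at u1 u2 u3 u4 u5 l1 l2 l3 l4
  have hr : rate 1 ((x + y : ℕ) / (B : ℝ)) ((x + z : ℕ) / (B : ℝ)) (y / (B : ℝ))
      = negMulLog ((x + y : ℕ) / (B : ℝ)) + negMulLog ((z + r : ℕ) / (B : ℝ))
        + negMulLog ((x + z : ℕ) / (B : ℝ)) + negMulLog ((y + r : ℕ) / (B : ℝ))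
        - negMulLog (x / (B : ℝ)) - negMulLog (z / (B : ℝ)) - negMulLog (y / (B : ℝ))
        - negMulLog (r / (B : ℝ)) := by
    have hBr : (B : ℝ) = x + y + z + r := by rw [hBdef]; push_cast; ring
    have e1 : 1 - ((x + y : ℕ) / (B : ℝ)) = (z + r : ℕ) / (B : ℝ) := by
      field_simp; push_cast; rw [hBr]; ring
    have e2 : 1 - ((x + z : ℕ) / (B : ℝ)) = (y + r : ℕ) / (B : ℝ) := by
      field_simp; push_cast; rw [hBr]; ring
    have e3 : ((x + y : ℕ) / (B : ℝ)) - y / B = x / B := by field_simp; push_cast; ring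
    have e4 : ((x + z : ℕ) / (B : ℝ)) - (x + y : ℕ) / B + y / B = z / B := by
      field_simp; push_cast; ring
    have e5 : ((y + r : ℕ) / (B : ℝ)) - y / B = r / B := by field_simp; push_cast; ring
    rw [rate, e1, e2, e3, e4, e5, Real.log_one]
    ring
  rw [hr]
  have h1 : (B : ℝ) / B = 1 := div_self hb.ne'
  rw [h1, negMulLog_one] at u1
  push_cast at *
  have hBr : (B : ℝ) = x + y + z + r := by rw [hBdef]; push_cast; ring
  have hlin : (B : ℝ) * log B = x * log B + y * log B + z * log B + r * log B := by
    nth_rewrite 1 [hBr]; ring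
  nlinarith

/-- Greedy covering with the hypergeometric probability `p`. A set `S` of the list misses exactly
`y` elements of the `K` it serves, so a query of size `y` is enough and the total cost is the
length, at most `(B + 1) / p`, times `c ^ y`. -/
theorem exists_cover_of_card (c : ℝ) (hc : 1 ≤ c) (x y z r B : ℕ) (hB : 0 < B)
    (hsum : x + y + z + r = B) :
    ∃ L : List (Finset ℕ), (∀ S ∈ L, S ⊆ range B ∧ #S = x + z) ∧
      (∀ K ⊆ range B, #K = x + y → ∃ S ∈ L, #(S ∩ K) = x) ∧
      (L.length : ℝ) * c ^ y ≤ (B + 1) * exp (B * rate c ((x + y : ℕ) / B) ((x + z : ℕ) / B) (y / B)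
        + 5 * (log (B + 1) + 1)) := by
  subst hsum
  set B := x + y + z + r with hBdef
  have hb : (0 : ℝ) < (B : ℝ) := by exact_mod_cast hB
  have hn1 : 0 < (x + y).choose x := Nat.choose_pos (by omega)
  have hn2 : 0 < (z + r).choose z := Nat.choose_pos (by omega)
  have hn3 : 0 < B.choose (x + z) := Nat.choose_pos (by omega)
  have hn1' : (0 : ℝ) < (x + y).choose x := by exact_mod_cast hn1
  have hn2' : (0 : ℝ) < (z + r).choose z := by exact_mod_cast hn2
  have hn3' : (0 : ℝ) < B.choose (x + z) := by exact_mod_cast hn3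
  set p : ℝ := ((x + y).choose x * (z + r).choose z : ℝ) / B.choose (x + z) with hp
  have hcount : ∀ K ∈ (range B).powersetCard (x + y),
      (x + y).choose x * (z + r).choose z
        ≤ #(((range B).powersetCard (x + z)).filter fun S => #(S ∩ K) = x) := by
    intro K hK
    rw [mem_powersetCard] at hK
    have := card_filter_card_inter hK.1 x z
    rwa [hK.2, card_range, show B - (x + y) = z + r by omega] at this
  have hp1 : p ≤ 1 := by
    rw [hp, div_le_one hn3']
    obtain ⟨K, hK⟩ : ((range B).powersetCard (x + y)).Nonempty := by
      rw [powersetCard_nonempty, card_range]; omega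
    have h1 := (hcount K hK).trans (card_filter_le _ _)
    rw [card_powersetCard, card_range] at h1
    exact_mod_cast h1
  obtain ⟨L, hL, hLS, hcov⟩ := exists_cover_list ((range B).powersetCard (x + z))
    ((range B).powersetCard (x + y)) (fun S K => #(S ∩ K) = x) p (by positivity) hp1
    (by rw [powersetCard_nonempty, card_range]; omega)
    (by
      intro K hK
      rw [card_powersetCard, card_range, hp, div_mul_cancel₀ _ hn3'.ne']
      exact_mod_cast hcount K hK) B
    (by rw [card_powersetCard, card_range]; exact Nat.choose_le_two_pow _ _)
  refine ⟨L, fun S hS => mem_powersetCard.1 (hLS S hS),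
    fun K hK hKc => hcov K (mem_powersetCard.2 ⟨hK, hKc⟩), ?_⟩
  have hlog := log_inv_hypergeometric_le x y z r hB
  rw [← hBdef] at hlog
  have hinv : (1 : ℝ) / p ≤ exp (B * rate 1 ((x + y : ℕ) / B) ((x + z : ℕ) / B) (y / B)
        + 5 * (log (B + 1) + 1)) := by
    rw [← Real.log_le_iff_le_exp (by positivity), hp, one_div_div]
    exact hlog
  have hrate : rate c ((x + y : ℕ) / B) ((x + z : ℕ) / B) (y / B)
      = y / B * log c + rate 1 ((x + y : ℕ) / B) ((x + z : ℕ) / B) (y / B) := by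
    simp only [rate, Real.log_one]; ring
  have hcy : c ^ y = exp (B * (y / B * log c)) := by
    rw [← mul_assoc, mul_div_cancel₀ _ hb.ne', Real.exp_nat_mul, Real.exp_log (by linarith)]
  rw [hrate, mul_add, add_assoc, Real.exp_add, ← hcy]
  calc (L.length : ℝ) * c ^ y ≤ ((B + 1) * (1 / p)) * c ^ y := by
        rw [mul_one_div]; gcongr
    _ ≤ ((B + 1) * exp (B * rate 1 ((x + y : ℕ) / B) ((x + z : ℕ) / B) (y / B)
        + 5 * (log (B + 1) + 1))) * c ^ y := by gcongr
    _ = _ := by ring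

end WSM

/-! ### From the rate of a covering to `amls`, and the covering family of a block. -/

namespace WSM

open Real Finset

/-! ### The objective function of `amls` -/

/-- Holds because `Real.log` ignores signs. It makes opposite terms of `rate` cancel in the
degenerate cases `τ = 0` and `τ = 1`. -/
theorem negMulLog_neg (x : ℝ) : negMulLog (-x) = -negMulLog x := by
  simp [negMulLog, Real.log_neg_eq_log]

theorem mul_binEntropy_div (s a : ℝ) (hs : s ≠ 0) :
    s * binEntropy (a / s) = negMulLog a + negMulLog (s - a) - negMulLog s := by
  have h1 := negMulLog_mul s (a / s)
  have h2 := negMulLog_mul s (1 - a / s)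
  have e1 : s * (a / s) = a := by field_simp
  have e2 : s * (1 - a / s) = s - a := by field_simp
  rw [e1] at h1
  rw [e2] at h2
  rw [binEntropy_eq_negMulLog_add_negMulLog_one_sub, h1, h2]
  ring

/-- With `y = (β κ - τ) / α`, that is, `τ + α y = β κ`, one has `γ = (κ - y) / τ` and `δ = y / (1 -
τ)`: the fraction of `S` inside `K`, and the fraction of the complement of `S` that belongs to `K`.
-/
theorem amlsG_eq_rate {α : ℝ} (hα : α ≠ 0) (β c κ τ : ℝ) :
    amlsG α β c κ τ = rate c κ τ ((β * κ - τ) / α) := by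
  have hγ : τ * binEntropy (amlsGamma α β κ τ) = negMulLog (κ - (β * κ - τ) / α)
      + negMulLog (τ - κ + (β * κ - τ) / α) - negMulLog τ := by
    by_cases hτ : τ = 0
    · subst hτ
      rw [show (0 : ℝ) - κ + (β * κ - 0) / α = -(κ - (β * κ - 0) / α) by ring, negMulLog_neg]
      simp
    · have e : amlsGamma α β κ τ = (κ - (β * κ - τ) / α) / τ := by
        rw [amlsGamma, if_neg hτ]; field_simp; ring
      rw [e, mul_binEntropy_div _ _ hτ]
      ring_nf
  have hδ : (1 - τ) * binEntropy (amlsDelta α β κ τ) = negMulLog ((β * κ - τ) / α)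
      + negMulLog (1 - τ - (β * κ - τ) / α) - negMulLog (1 - τ) := by
    by_cases hτ : τ = 1
    · subst hτ
      rw [show (1 : ℝ) - 1 - (β * κ - 1) / α = -((β * κ - 1) / α) by ring, negMulLog_neg]
      simp
    · have hτ' : 1 - τ ≠ 0 := sub_ne_zero.2 (Ne.symm hτ)
      have e : amlsDelta α β κ τ = ((β * κ - τ) / α) / (1 - τ) := by
        rw [amlsDelta, if_neg hτ]; ring
      rw [e, mul_binEntropy_div _ _ hτ']
  rw [amlsG, hγ, hδ, rate, binEntropy_eq_negMulLog_add_negMulLog_one_sub]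
  ring

theorem amlsM_nonneg {α β : ℝ} (hβ : 1 < β) {κ : ℝ} (h0 : 0 ≤ κ) (h1 : β * κ ≤ 1) :
    0 ≤ amlsM α β κ := by
  unfold amlsM
  split_ifs with h h'
  · have : α * κ ≤ β * κ := by gcongr
    exact mul_nonneg (div_nonneg (by linarith) (by linarith)) h0
  · exact le_rfl
  · have : β < α := lt_of_le_of_ne (not_lt.1 h) (Ne.symm h')
    exact mul_nonneg (div_nonneg (by linarith) (by linarith)) h0

theorem amlsM_le {α β : ℝ} (hα : 1 ≤ α) (hβ : 1 < β) {κ : ℝ} (h0 : 0 ≤ κ) (h1 : β * κ ≤ 1) :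
    amlsM α β κ ≤ β * κ := by
  unfold amlsM
  split_ifs with h h'
  · have hk : α * κ ≤ β * κ := by gcongr
    rcases h0.eq_or_lt with rfl | h0
    · simp
    have : α * κ < 1 := by nlinarith
    gcongr
    rw [div_le_iff₀ (by linarith)]
    nlinarith
  · positivity
  · have : β < α := lt_of_le_of_ne (not_lt.1 h) (Ne.symm h')
    gcongr
    rw [div_le_iff₀ (by linarith)]
    nlinarith

/-- The range of `τ` describes feasible proportions. -/
structure IsFeasible (κ τ y : ℝ) : Prop where
  nonneg : 0 ≤ y
  le : y ≤ κ
  le_add : κ ≤ τ + y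
  add_le : τ + y ≤ 1

/-- This is the role of `M`. The condition `y ≤ κ` means `(β - α) κ ≤ τ`, and `κ ≤ τ + y` means `(α
- β) κ ≤ (α - 1) τ`. For `α > β` the bound `M` is the second condition; for `α < β` it is at least
`(β - α) κ`, because `1 - α κ ≤ 1`. The bound `τ + y ≤ 1` follows from `β κ ≤ 1` and `α ≥ 1`. -/
theorem isFeasible_of_mem {α β : ℝ} (hα : 1 ≤ α) (hβ : 1 < β) {κ τ : ℝ} (h0 : 0 ≤ κ)
    (h1 : β * κ ≤ 1) (hτ : τ ∈ Set.Icc (amlsM α β κ) (β * κ)) : IsFeasible κ τ ((β * κ - τ) / α) := by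
  have hα0 : 0 < α := by linarith
  have hM := amlsM_nonneg (α := α) hβ h0 h1
  obtain ⟨hτ1, hτ2⟩ := hτ
  have hτ0 : 0 ≤ τ := hM.trans hτ1
  refine ⟨div_nonneg (by linarith) hα0.le, ?_, ?_, ?_⟩
  · rw [div_le_iff₀ hα0]
    by_cases h : α < β
    · rw [amlsM, if_pos h] at hτ1
      rcases h0.eq_or_lt with rfl | h0
      · nlinarith
      have hk : α * κ < β * κ := by gcongr
      have h2 : (β - α) * κ ≤ (β - α) / (1 - α * κ) * κ := by
        gcongr
        rw [le_div_iff₀ (by linarith)]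
        have : 0 ≤ α * κ := by positivity
        nlinarith
      linarith
    · nlinarith
  · have key : (α - β) * κ ≤ (α - 1) * τ := by
      by_cases h : β < α
      · rw [amlsM, if_neg (by linarith), if_neg (by linarith)] at hτ1
        have h1 : 0 < α - 1 := by linarith
        calc (α - β) * κ = (α - 1) * ((α - β) / (α - 1) * κ) := by field_simp
          _ ≤ _ := by gcongr
      · have : (α - β) * κ ≤ 0 := mul_nonpos_of_nonpos_of_nonneg (by linarith) h0
        have : 0 ≤ (α - 1) * τ := mul_nonneg (by linarith) hτ0
        linarith
    have : κ - τ ≤ (β * κ - τ) / α := by rw [le_div_iff₀ hα0]; linarith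
    linarith
  · have : (β * κ - τ) / α ≤ 1 - τ := by
      rw [div_le_iff₀ hα0]
      nlinarith [mul_nonneg (show 0 ≤ α - 1 by linarith) (show 0 ≤ 1 - τ by linarith)]
    linarith

/-- Keeps `sInf` away from its default value. The entropies of `γ` and `δ` enter negatively, and
`binEntropy ≤ log 2` holds on all of `ℝ`, so `γ, δ ∈ [0, 1]` need not be checked. -/
theorem bddBelow_amlsG {α c β : ℝ} (hα : 1 ≤ α) (hc : 1 ≤ c) (hβ : 1 < β)
    {κ : ℝ} (h0 : 0 ≤ κ) (h1 : β * κ ≤ 1) :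
    BddBelow (amlsG α β c κ '' Set.Icc (amlsM α β κ) (β * κ)) := by
  refine ⟨-(2 * log 2), ?_⟩
  rintro _ ⟨τ, ⟨hτ1, hτ2⟩, rfl⟩
  have hτ0 : 0 ≤ τ := (amlsM_nonneg hβ h0 h1).trans hτ1
  have hl : 0 ≤ log 2 := Real.log_nonneg (by norm_num)
  have a1 : 0 ≤ (β * κ - τ) / α * log c :=
    mul_nonneg (div_nonneg (by linarith) (by linarith)) (Real.log_nonneg hc)
  have a2 : τ * binEntropy (amlsGamma α β κ τ) ≤ 1 * log 2 :=
    (mul_le_mul_of_nonneg_left binEntropy_le_log_two hτ0).trans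
      (mul_le_mul_of_nonneg_right (by linarith) hl)
  have a3 : (1 - τ) * binEntropy (amlsDelta α β κ τ) ≤ 1 * log 2 :=
    (mul_le_mul_of_nonneg_left binEntropy_le_log_two (by linarith)).trans
      (mul_le_mul_of_nonneg_right (by linarith) hl)
  have a4 : 0 ≤ binEntropy κ := binEntropy_nonneg h0 (by nlinarith)
  rw [amlsG]
  linarith

/-- Test with `τ = β κ`, where the query size is zero: the `log c` term vanishes, the subtracted
entropies are nonnegative, and `binEntropy κ ≤ log 2` remains. -/
theorem bddAbove_sInf_amlsG {α c β : ℝ} (hα : 1 ≤ α) (hc : 1 ≤ c) (hβ : 1 < β) :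
    BddAbove ((fun κ : ℝ =>
      sInf (amlsG α β c κ '' Set.Icc (amlsM α β κ) (β * κ))) '' Set.Icc 0 (1 / β)) := by
  have hβ0 : 0 < β := by linarith
  refine ⟨log 2, ?_⟩
  rintro _ ⟨κ, ⟨h0, h1⟩, rfl⟩
  rw [le_div_iff₀ hβ0, mul_comm] at h1
  refine (csInf_le (bddBelow_amlsG hα hc hβ h0 h1)
    ⟨β * κ, ⟨amlsM_le hα hβ h0 h1, le_rfl⟩, rfl⟩).trans ?_
  have hγ : 0 ≤ binEntropy (amlsGamma α β κ (β * κ)) := by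
    rw [amlsGamma]
    split_ifs with h
    · exact binEntropy_nonneg (by positivity) (by rw [div_le_one (by linarith)]; exact hα)
    · have hκ : κ ≠ 0 := by rintro rfl; simp at h
      have hα0 : α ≠ 0 := by linarith
      have e : (1 - β / α) * (κ / (β * κ)) + 1 / α = 1 / β := by field_simp; ring
      rw [e]
      exact binEntropy_nonneg (by positivity) (by rw [div_le_one (by linarith)]; exact hβ.le)
  have hδ : 0 ≤ binEntropy (amlsDelta α β κ (β * κ)) := by
    rw [amlsDelta]
    split_ifs with h
    · exact binEntropy_nonneg (by positivity) (by rw [div_le_one (by linarith)]; exact hα)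
    · rw [show β / α * κ - β * κ / α = 0 by ring]; simp
  have h2 : 0 ≤ β * κ * binEntropy (amlsGamma α β κ (β * κ)) := by positivity
  have h3 : 0 ≤ (1 - β * κ) * binEntropy (amlsDelta α β κ (β * κ)) :=
    mul_nonneg (by linarith) hδ
  rw [amlsG]
  simp only [sub_self, zero_div, zero_mul]
  have := @binEntropy_le_log_two κ
  linarith

theorem exists_amlsG_lt {α c β : ℝ} (hα : 1 ≤ α) (hc : 1 ≤ c) (hβ : 1 < β)
    {κ : ℝ} (h0 : 0 ≤ κ) (h1 : β * κ ≤ 1) {η : ℝ} (hη : 0 < η) :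
    ∃ τ ∈ Set.Icc (amlsM α β κ) (β * κ), amlsG α β c κ τ < log (amls α c β) + η := by
  have hβ0 : 0 < β := by linarith
  have hle := le_csSup (bddAbove_sInf_amlsG hα hc hβ)
    ⟨κ, ⟨h0, by rwa [le_div_iff₀ hβ0, mul_comm]⟩, rfl⟩
  obtain ⟨_, ⟨τ, hτ, rfl⟩, hlt⟩ := exists_lt_of_csInf_lt
    (s := amlsG α β c κ '' Set.Icc (amlsM α β κ) (β * κ))
    ⟨_, ⟨β * κ, ⟨amlsM_le hα hβ h0 h1, le_rfl⟩, rfl⟩⟩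
    (lt_of_le_of_lt hle (lt_add_of_pos_right _ hη))
  exact ⟨τ, hτ, by rwa [amls, Real.log_exp]⟩

/-- The choice `κ = 0` forces `τ = 0`, where `g` vanishes. -/
theorem one_le_amls {α c β : ℝ} (hα : 1 ≤ α) (hc : 1 ≤ c) (hβ : 1 < β) :
    1 ≤ amls α c β := by
  have hβ0 : 0 < β := by linarith
  rw [amls]
  apply Real.one_le_exp
  have hle := le_csSup (bddAbove_sInf_amlsG hα hc hβ)
    ⟨0, ⟨le_rfl, by positivity⟩, rfl⟩
  have hM : amlsM α β 0 = 0 := by unfold amlsM; split_ifs <;> simp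
  simp only [mul_zero, hM, Set.Icc_self, Set.image_singleton, csInf_singleton] at hle
  have : amlsG α β c 0 0 = 0 := by simp [amlsG, amlsDelta]
  rw [this] at hle
  exact hle

/-! ### Rounding to integers -/

/-- Six entropy terms depend on `τ` and `y`, and feasibility keeps their arguments in `[0, 1]`. The
term `y log c` can only decrease, since `y' ≤ y` and `c ≥ 1`. -/
theorem rate_le_of_close {c δ ξ κ τ y τ' y' : ℝ} (hc : 1 ≤ c)
    (hδ : ∀ u ∈ Set.Icc (0 : ℝ) 1, ∀ v ∈ Set.Icc (0 : ℝ) 1, |u - v| ≤ δ →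
      |negMulLog u - negMulLog v| ≤ ξ)
    (h : IsFeasible κ τ y) (h' : IsFeasible κ τ' y') (hy : y' ≤ y)
    (h1 : |τ' - τ| ≤ δ) (h2 : |y' - y| ≤ δ) (h3 : |(τ' + y') - (τ + y)| ≤ δ) :
    rate c κ τ' y' ≤ rate c κ τ y + 6 * ξ := by
  obtain ⟨a1, a2, a3, a4⟩ := h
  obtain ⟨b1, b2, b3, b4⟩ := h'
  have hl := mul_le_mul_of_nonneg_right hy (Real.log_nonneg hc)
  have e1 := hδ τ' ⟨by linarith, by linarith⟩ τ ⟨by linarith, by linarith⟩ h1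
  have e2 := hδ (1 - τ') ⟨by linarith, by linarith⟩ (1 - τ) ⟨by linarith, by linarith⟩
    (by rw [abs_sub_comm, show 1 - τ - (1 - τ') = τ' - τ by ring]; exact h1)
  have e3 := hδ (κ - y') ⟨by linarith, by linarith⟩ (κ - y) ⟨by linarith, by linarith⟩
    (by rw [abs_sub_comm, show κ - y - (κ - y') = y' - y by ring]; exact h2)
  have e4 := hδ (τ' - κ + y') ⟨by linarith, by linarith⟩ (τ - κ + y) ⟨by linarith, by linarith⟩
    (by rw [show τ' - κ + y' - (τ - κ + y) = τ' + y' - (τ + y) by ring]; exact h3)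
  have e5 := hδ y' ⟨by linarith, by linarith⟩ y ⟨by linarith, by linarith⟩ h2
  have e6 := hδ (1 - τ' - y') ⟨by linarith, by linarith⟩ (1 - τ - y) ⟨by linarith, by linarith⟩
    (by rw [abs_sub_comm, show 1 - τ - y - (1 - τ' - y') = τ' + y' - (τ + y) by ring]; exact h3)
  rw [abs_le] at e1 e2 e3 e4 e5 e6
  unfold rate
  linarith [e1.2, e2.2, e3.1, e4.1, e5.1, e6.1]

theorem exists_negMulLog_modulus {ξ : ℝ} (hξ : 0 < ξ) : ∃ δ > 0,
    ∀ u ∈ Set.Icc (0 : ℝ) 1, ∀ v ∈ Set.Icc (0 : ℝ) 1, |u - v| ≤ δ →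
      |negMulLog u - negMulLog v| ≤ ξ := by
  have hu := isCompact_Icc.uniformContinuousOn_of_continuous
    (continuous_negMulLog.continuousOn (s := Set.Icc (0 : ℝ) 1))
  obtain ⟨δ, hδ, h⟩ := Metric.uniformContinuousOn_iff.1 hu ξ hξ
  refine ⟨δ / 2, by positivity, fun u hu v hv huv => (h u hu v hv ?_).le⟩
  rw [Real.dist_eq]
  linarith

/-- Integral parameters for sets with `k` elements: a set with `x + z` elements which meets a set
with `k = x + y` elements in `x` elements. -/
theorem exists_integral_parameters {α c β : ℝ} (hα : 1 ≤ α) (hc : 1 ≤ c) (hβ : 1 < β) {η : ℝ}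
    (hη : 0 < η) : ∃ B₀ : ℕ, ∀ B : ℕ, B₀ ≤ B → 0 < B → ∀ k : ℕ, β * k ≤ B →
      ∃ x y z r : ℕ, x + y + z + r = B ∧ x + y = k ∧ ((x + z : ℕ) : ℝ) + α * y ≤ β * k ∧
        rate c ((x + y : ℕ) / B) ((x + z : ℕ) / B) (y / B) ≤ log (amls α c β) + η := by
  -- Six entropy terms moving by `η / 12` each use up `η / 2`; the other half pays for approximating
  -- the infimum over `τ`.
  obtain ⟨δ, hδ0, hδ⟩ := exists_negMulLog_modulus (show 0 < η / 12 by positivity)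
  obtain ⟨B₀, hB₀⟩ := exists_nat_ge (1 / δ)
  refine ⟨B₀, fun B hB hBpos k hk => ?_⟩
  have hb : (0 : ℝ) < B := by exact_mod_cast hBpos
  have hα0 : 0 < α := by linarith
  have hBδ : 1 / (B : ℝ) ≤ δ := by
    have : (1 : ℝ) / δ ≤ B := hB₀.trans (by exact_mod_cast hB)
    rw [div_le_iff₀ hδ0] at this
    rw [div_le_iff₀ hb]; linarith
  set κ : ℝ := k / B with hκ
  have h0 : 0 ≤ κ := by positivity
  have h1 : β * κ ≤ 1 := by rw [hκ, ← mul_div_assoc, div_le_one hb]; exact hk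
  obtain ⟨τ, hτ, hlt⟩ := exists_amlsG_lt hα hc hβ h0 h1 (show 0 < η / 2 by positivity)
  have hf := isFeasible_of_mem hα hβ h0 h1 hτ
  rw [amlsG_eq_rate hα0.ne'] at hlt
  set y : ℝ := (β * κ - τ) / α with hy
  have hαy : τ + α * y = β * κ := by rw [hy]; field_simp; ring
  have hBκ : B * κ = k := by rw [hκ]; field_simp
  have hτ0 : 0 ≤ τ := (amlsM_nonneg hβ h0 h1).trans hτ.1
  have f1 := Nat.floor_le (show 0 ≤ B * y from mul_nonneg hb.le hf.nonneg)
  have f2 := Nat.lt_floor_add_one (B * y)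
  have f3 := Nat.floor_le (show 0 ≤ B * (τ + y) from mul_nonneg hb.le (by linarith [hf.nonneg]))
  have f4 := Nat.lt_floor_add_one (B * (τ + y))
  -- Rounding down `y` and `τ + y`, rather than `τ`, preserves `Y ≤ k ≤ V ≤ B` because `k` and `B`
  -- are integers. It also preserves the weight bound, since `τ + α y = (τ + y) + (α - 1) y` has
  -- nonnegative coefficients. The parameters are `x = k - Y`, `z = V - k`, `r = B - V`.
  set Y := ⌊B * y⌋₊
  set V := ⌊B * (τ + y)⌋₊ with hV
  have g1 : Y ≤ k := by
    have : (Y : ℝ) ≤ k := f1.trans (by rw [← hBκ]; exact mul_le_mul_of_nonneg_left hf.le hb.le)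
    exact_mod_cast this
  have g2 : k ≤ V := by
    apply Nat.le_floor
    rw [← hBκ]; exact mul_le_mul_of_nonneg_left hf.le_add hb.le
  have g3 : V ≤ B := by
    have : (V : ℝ) ≤ B := f3.trans
      (by nth_rewrite 2 [← mul_one (B : ℝ)]; exact mul_le_mul_of_nonneg_left hf.add_le hb.le)
    exact_mod_cast this
  obtain ⟨x, hx⟩ := Nat.exists_eq_add_of_le g1
  obtain ⟨z, hz⟩ := Nat.exists_eq_add_of_le g2
  obtain ⟨r, hr⟩ := Nat.exists_eq_add_of_le g3
  refine ⟨x, Y, z, r, by omega, by omega, ?_, ?_⟩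
  · have hV' : (V : ℝ) = Y + x + z := by rw [hz, hx]; push_cast; ring
    push_cast
    have : B * τ + α * (B * y) = β * k := by rw [← hBκ, mul_left_comm β, ← hαy]; ring
    nlinarith [mul_nonneg (show 0 ≤ α - 1 by linarith) (show 0 ≤ B * y - Y by linarith)]
  · have hT : ((x + z : ℕ) : ℝ) = V - Y := by
      rw [hz, hx]; push_cast; ring
    have hkk : ((x + Y : ℕ) : ℝ) / B = κ := by rw [hκ, hx, add_comm]
    rw [hkk, hT]
    have q1 : |(Y : ℝ) / B - y| ≤ δ := by
      refine le_trans ?_ hBδ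
      have : (Y : ℝ) / B - y = (Y - B * y) / B := by field_simp
      rw [this, abs_div, abs_of_pos hb]
      gcongr
      rw [abs_le]; constructor <;> linarith
    have q2 : |((V : ℝ) - Y) / B - τ| ≤ δ := by
      refine le_trans ?_ hBδ
      have : ((V : ℝ) - Y) / B - τ = (V - Y - B * τ) / B := by field_simp
      rw [this, abs_div, abs_of_pos hb]
      gcongr
      rw [abs_le]; constructor <;> linarith
    have q3 : |((V : ℝ) - Y) / B + Y / B - (τ + y)| ≤ δ := by
      refine le_trans ?_ hBδ
      have : ((V : ℝ) - Y) / B + Y / B - (τ + y) = (V - B * (τ + y)) / B := by field_simp; ring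
      rw [this, abs_div, abs_of_pos hb]
      gcongr
      rw [abs_le]; constructor <;> linarith
    have hf' : IsFeasible κ (((V : ℝ) - Y) / B) (Y / B) := by
      have e : ((V : ℝ) - Y) / B + Y / B = V / B := by ring
      refine ⟨by positivity, ?_, ?_, ?_⟩
      · rw [hκ]; gcongr
      · rw [e, hκ]; gcongr
      · rw [e, div_le_one hb]; exact_mod_cast g3
    have := rate_le_of_close hc hδ hf hf' (by rw [div_le_iff₀ hb]; linarith) q2 q1 q3
    linarith

/-! ### The covering family -/

/-- The set `S` together with an extension of at most `ℓ` elements is a good enough substitute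
for `K`, if all elements have the same weight. -/
def Covers (α β : ℝ) (S : Finset ℕ) (ℓ : ℕ) (K : Finset ℕ) : Prop :=
  #(K \ S) ≤ ℓ ∧ (#(S \ K) : ℝ) + (α - 1) * #(K \ S) ≤ (β - 1) * #K

/-- The second condition of `Covers` is `|S| + α |K \ S| ≤ β |K|` after removing `|S ∩ K|`. If `β k
≤ B`, the integral parameters and their covering apply. Otherwise the whole block, of size less than
`β k`, is itself cheap enough and needs no query elements. -/
theorem exists_list_covers_card {α c β : ℝ} (hα : 1 ≤ α) (hc : 1 ≤ c) (hβ : 1 < β) {η : ℝ}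
    (hη : 0 < η) : ∃ B₀ : ℕ, ∀ B : ℕ, B₀ ≤ B → 0 < B → ∀ k : ℕ,
      ∃ L : List (Finset ℕ × ℕ), (∀ K ⊆ range B, #K = k → ∃ e ∈ L, Covers α β e.1 e.2 K) ∧
        (L.map fun e => c ^ e.2).sum ≤
          (B + 1) * exp (B * (log (amls α c β) + η) + 5 * (log (B + 1) + 1)) := by
  obtain ⟨B₀, hB₀⟩ := exists_integral_parameters hα hc hβ hη
  refine ⟨B₀, fun B hB hBpos k => ?_⟩
  have hb : (0 : ℝ) < B := by exact_mod_cast hBpos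
  by_cases hk : β * k ≤ B
  · obtain ⟨x, y, z, r, hs, rfl, hw, hr⟩ := hB₀ B hB hBpos k hk
    obtain ⟨L, hL, hcov, hlen⟩ := exists_cover_of_card c hc x y z r B hBpos hs
    refine ⟨L.map fun S => (S, y), ?_, ?_⟩
    · intro K hK hKc
      obtain ⟨S, hS, hSK⟩ := hcov K hK hKc
      refine ⟨(S, y), List.mem_map.2 ⟨S, hS, rfl⟩, ?_⟩
      have h1 : #(K \ S) = y := by
        have := Finset.card_inter_add_card_sdiff K S
        rw [inter_comm] at this; omega
      have h2 : #(S \ K) = z := by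
        have := Finset.card_inter_add_card_sdiff S K
        have := (hL S hS).2; omega
      refine ⟨h1.le, ?_⟩
      simp only [h1, h2, hKc]
      push_cast at hw ⊢
      linarith
    · have : ((L.map fun S => (S, y)).map fun e => c ^ e.2).sum = L.length * c ^ y := by
        simp [List.map_map, Function.comp_def]
      rw [this]
      refine hlen.trans ?_
      gcongr
  · refine ⟨[(range B, 0)], ?_, ?_⟩
    · intro K hK hKc
      refine ⟨_, List.mem_singleton.2 rfl, ?_⟩
      have h1 : #(K \ range B) = 0 := by rw [card_eq_zero, sdiff_eq_empty_iff_subset]; exact hK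
      have h2 : #(range B \ K) + k = B := by
        rw [← hKc, card_sdiff_add_card_eq_card hK, card_range]
      have h2' : (#(range B \ K) : ℝ) + k = B := by exact_mod_cast h2
      refine ⟨h1.le, ?_⟩
      simp only [h1, hKc]
      push_cast
      linarith
    · have hA := Real.log_nonneg (one_le_amls hα hc hβ)
      have hl : 0 ≤ log ((B : ℝ) + 1) := Real.log_nonneg (by linarith)
      have h1 : 1 ≤ exp (B * (log (amls α c β) + η) + 5 * (log (B + 1) + 1)) :=
        Real.one_le_exp (by positivity)
      simp
      nlinarith

/-- A finite family which covers all subsets of `{0, …, B-1}` and whose total query cost is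
exponential in `B` with base `amls(α,c,β) + ε`. -/
theorem exists_covering_family {α c β ε : ℝ} (hα : 1 ≤ α) (hc : 1 ≤ c) (hβ : 1 < β) (hε : 0 < ε) :
    ∃ B : ℕ, 0 < B ∧ ∃ L : List (Finset ℕ × ℕ),
      (∀ K ⊆ range B, ∃ e ∈ L, Covers α β e.1 e.2 K) ∧
        (L.map fun e => c ^ e.2).sum ≤ (amls α c β + ε) ^ B := by
  have hA := one_le_amls hα hc hβ
  set A := amls α c β with hAdef
  -- One `η` is the loss in the rate; the other absorbs the factors polynomial in `B`.
  set η := (log (A + ε) - log A) / 2 with hηdef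
  have hη : 0 < η := by
    have := Real.log_lt_log (by linarith) (show A < A + ε by linarith)
    rw [hηdef]; linarith
  obtain ⟨B₀, hB₀⟩ := exists_list_covers_card hα hc hβ hη
  -- The seven logarithms: one for the `B + 1` possible sizes of `K`, one for the factor `B + 1` of
  -- the greedy covering, five from the factorials, which also leave the constant `5`.
  have hlim : ∀ᶠ B : ℕ in Filter.atTop, 7 * log ((B : ℝ) + 1) + 5 ≤ η * B := by
    have h1 : Filter.Tendsto (fun B : ℕ => (B : ℝ) + 1) Filter.atTop Filter.atTop :=
      Filter.tendsto_atTop_add_const_right _ _ tendsto_natCast_atTop_atTop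
    have h2 := h1.eventually (Real.isLittleO_log_id_atTop.bound (show 0 < η / 14 by positivity))
    have h3 := tendsto_natCast_atTop_atTop.eventually_ge_atTop ((η / 2 + 5) / (η / 2))
    filter_upwards [h2, h3] with B hB hB'
    simp only [id, Real.norm_eq_abs] at hB
    rw [div_le_iff₀ (by positivity)] at hB'
    have hp : (0 : ℝ) ≤ (B : ℝ) + 1 := by positivity
    rw [abs_of_nonneg hp] at hB
    have := (le_abs_self _).trans hB
    linarith
  obtain ⟨B, ⟨hB7, hBB₀⟩, hBpos⟩ := ((hlim.and (Filter.eventually_ge_atTop B₀)).and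
    (Filter.eventually_gt_atTop 0)).exists
  choose Lk hcov hcost using hB₀ B hBB₀ hBpos
  refine ⟨B, hBpos, (List.range (B + 1)).flatMap Lk, ?_, ?_⟩
  · intro K hK
    obtain ⟨e, he, hc⟩ := hcov #K K hK rfl
    refine ⟨e, List.mem_flatMap.2 ⟨#K, List.mem_range.2 ?_, he⟩, hc⟩
    have := card_le_card hK
    rw [card_range] at this
    omega
  · set Q := (B + 1) * exp (B * (log A + η) + 5 * (log (B + 1) + 1)) with hQ
    have hsum : ∀ m : ℕ, ((((List.range m).flatMap Lk)).map fun e => c ^ e.2).sum ≤ m * Q := by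
      intro m
      induction m with
      | zero => simp
      | succ m ih =>
        rw [List.range_succ, List.flatMap_append, List.map_append, List.sum_append]
        simp only [List.flatMap_singleton]
        push_cast
        linarith [hcost m]
    refine (hsum (B + 1)).trans ?_
    have hp : (0 : ℝ) < (B : ℝ) + 1 := by positivity
    have e1 : ((B + 1 : ℕ) : ℝ) * Q
        = exp (log (B + 1) + (log (B + 1) + (B * (log A + η) + 5 * (log (B + 1) + 1)))) := by
      rw [Real.exp_add (log _), Real.exp_add (log _), Real.exp_log hp, hQ]
      push_cast; ring
    have e2 : (A + ε) ^ B = exp (B * log (A + ε)) := by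
      rw [Real.exp_nat_mul, Real.exp_log (by linarith)]
    rw [e1, e2]
    apply Real.exp_le_exp.2
    have : log (A + ε) = log A + 2 * η := by rw [hηdef]; ring
    rw [this]
    linarith

end WSM

/-! ### From cardinalities in blocks to weights along the sorted order. -/

namespace WSM

open Finset

/-! ### The weight argument on positions -/

theorem sum_range_add_mul {M : Type*} [AddCommMonoid M] (f : ℕ → M) (s B N : ℕ) :
    ∑ p ∈ range (s + N * B), f p
      = ∑ p ∈ range s, f p + ∑ j ∈ range N, ∑ b ∈ range B, f (s + j * B + b) := by
  induction N with
  | zero => simp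
  | succ N ih =>
    rw [Nat.succ_mul, ← add_assoc, Finset.sum_range_add, ih, Finset.sum_range_succ _ N, add_assoc]

/-- The set of positions chosen by the guesses `q`, the start position `s` of the blocks of
size `B`, and the sets `X j` chosen inside the `N` blocks. -/
def positions (A B N : ℕ) (q : ℕ → ℕ) (s : ℕ) (X : ℕ → Finset ℕ) : Set ℕ :=
  {p | (∃ j < A, q j = p) ∨ ∃ j < N, ∃ b < B, b ∈ X j ∧ s + j * B + b = p}

/-- The count grows by at most one as `s` advances, so it either hits `B` exactly or `s` reaches the
end. -/
theorem exists_split_card_le (R : Finset ℕ) (B n : ℕ) :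
    ∃ s ≤ n, #(R.filter (· < s)) ≤ B ∧ (#(R.filter (· < s)) = B ∨ s = n) := by
  induction n with
  | zero => exact ⟨0, le_rfl, by simp, Or.inr rfl⟩
  | succ n ih =>
    obtain ⟨s, hs, hle, h | rfl⟩ := ih
    · exact ⟨s, by omega, hle, Or.inl h⟩
    · by_cases h : #(R.filter (· < s)) = B
      · exact ⟨s, by omega, hle, Or.inl h⟩
      · refine ⟨s + 1, le_rfl, ?_, Or.inr rfl⟩
        have hsub : R.filter (· < s + 1) ⊆ insert s (R.filter (· < s)) := by
          intro p; simp only [mem_filter, mem_insert]; rintro ⟨h1, h2⟩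
          rcases Nat.lt_succ_iff_lt_or_eq.1 h2 with h3 | h3
          · exact Or.inr ⟨h1, h3⟩
          · exact Or.inl h3
        have := (card_le_card hsub).trans (card_insert_le _ _)
        omega

/-- A set of at most `B` numbers below `n` is enumerated by `B` numbers, up to the dummy `n`. -/
theorem exists_enum_of_card_le (T : Finset ℕ) (B n : ℕ) (hT : ∀ p ∈ T, p < n) (hc : #T ≤ B) :
    ∃ q : ℕ → ℕ, (∀ j, q j ≤ n) ∧ ∀ p < n, (∃ j < B, q j = p) ↔ p ∈ T := by
  refine ⟨fun j => T.toList.getD j n, fun j => ?_, fun p hp => ⟨?_, fun hpT => ?_⟩⟩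
  · by_cases h : j < T.toList.length
    · simp only [List.getD_eq_getElem _ _ h]
      exact (hT _ (mem_toList.1 (List.getElem_mem h))).le
    · simp only [List.getD_eq_default _ _ (not_lt.1 h)]
      exact le_rfl
  · rintro ⟨j, -, hj⟩
    by_cases h : j < T.toList.length
    · simp only [List.getD_eq_getElem _ _ h] at hj
      rw [← hj]; exact mem_toList.1 (List.getElem_mem h)
    · simp only [List.getD_eq_default _ _ (not_lt.1 h)] at hj
      omega
  · obtain ⟨j, hj, hjp⟩ := List.getElem_of_mem (mem_toList.2 hpT)
    refine ⟨j, lt_of_lt_of_le hj (by rwa [length_toList]), ?_⟩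
    simp only [List.getD_eq_getElem _ _ hj, hjp]

/-- The inequality for a single block. -/
theorem sum_block_le {α β : ℝ} (hα : 1 ≤ α) (hβ : 1 < β) {W : ℕ → ℝ} (hW : Antitone W)
    (hW0 : ∀ p, 0 ≤ W p) (a B : ℕ) {S K : Finset ℕ} {ℓ : ℕ} (hK : K ⊆ range B)
    (h : Covers α β S ℓ K) :
    ∑ b ∈ range B, W (a + b) * ((if b ∈ S then 1 else 0) + α * (if b ∈ K ∧ b ∉ S then 1 else 0)
      - β * (if b ∈ K then 1 else 0)) ≤ (β - 1) * B * (W a - W (a + B)) := by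
  -- The coefficient is split as `[S \ K] + (α - 1) [K \ S] - (β - 1) [K]`. Positive parts are
  -- charged at the largest weight `W a`, the negative part at the lower bound `W (a + B)`; `Covers`
  -- then leaves `(β - 1) |K| (W a - W (a + B))`.
  have hpt : ∀ b ∈ range B, W (a + b) * ((if b ∈ S then 1 else 0)
      + α * (if b ∈ K ∧ b ∉ S then 1 else 0) - β * (if b ∈ K then 1 else 0))
      ≤ W a * (if b ∈ S \ K then 1 else 0) + (α - 1) * W a * (if b ∈ K \ S then 1 else 0)
        - (β - 1) * W (a + B) * (if b ∈ K then 1 else 0) := by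
    intro b hb
    have h1 : W (a + b) ≤ W a := hW (by omega)
    have h2 : W (a + B) ≤ W (a + b) := hW (by have := mem_range.1 hb; omega)
    have h3 := mul_le_mul_of_nonneg_left h1 (show 0 ≤ α - 1 by linarith)
    have h4 := mul_le_mul_of_nonneg_left h2 (show 0 ≤ β - 1 by linarith)
    by_cases hS : b ∈ S <;> by_cases hK : b ∈ K <;> simp [hS, hK] <;> nlinarith
  refine (sum_le_sum hpt).trans ?_
  have card1 : ∀ Z : Finset ℕ, ∑ b ∈ range B, (if b ∈ Z then (1 : ℝ) else 0) ≤ #Z := by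
    intro Z
    rw [sum_boole]
    exact_mod_cast card_le_card fun b hb => (mem_filter.1 hb).2
  have card2 : ∑ b ∈ range B, (if b ∈ K then (1 : ℝ) else 0) = #K := by
    rw [sum_boole, filter_mem_eq_inter, inter_eq_right.2 hK]
  rw [sum_sub_distrib, sum_add_distrib, ← mul_sum, ← mul_sum, ← mul_sum, card2]
  have c1 := mul_le_mul_of_nonneg_left (card1 (S \ K)) (hW0 a)
  have c2 := mul_le_mul_of_nonneg_left (card1 (K \ S))
    (mul_nonneg (show 0 ≤ α - 1 by linarith) (hW0 a))
  have hcov := mul_le_mul_of_nonneg_left h.2 (hW0 a)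
  have hKB : (#K : ℝ) ≤ B := by
    have := card_le_card hK; rw [card_range] at this; exact_mod_cast this
  have hd : 0 ≤ (β - 1) * (W a - W (a + B)) :=
    mul_nonneg (by linarith) (by linarith [hW (show a ≤ a + B by omega)])
  have := mul_le_mul_of_nonneg_right hKB hd
  nlinarith

open Classical in
/-- There are guesses for which the chosen set of positions and an extension of small size are a
substitute for `R` of weight at most `β` times the weight of `R`. -/
theorem exists_good_positions {α β : ℝ} (hα : 1 ≤ α) (hβ : 1 < β) {B : ℕ}
    {L : List (Finset ℕ × ℕ)} (hL : ∀ K ⊆ range B, ∃ e ∈ L, Covers α β e.1 e.2 K)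
    {n N : ℕ} (hN : n ≤ N * B) {W : ℕ → ℝ} (hW : Antitone W) (hW0 : ∀ p, 0 ≤ W p)
    (hWn : ∀ p, n ≤ p → W p = 0) {R : Finset ℕ} (hR : R ⊆ range n) :
    ∃ (q : ℕ → ℕ) (s : ℕ) (d : ℕ → ℕ), (∀ j, q j ≤ n) ∧ s ≤ n ∧ (∀ j, d j < L.length) ∧
      #(R.filter (· ∉ positions B B N q s fun j => (L.getD (d j) (∅, 0)).1))
        ≤ ∑ j ∈ range N, (L.getD (d j) (∅, 0)).2 ∧
      ∑ p ∈ (range n).filter (· ∈ positions B B N q s fun j => (L.getD (d j) (∅, 0)).1), W p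
        + α * ∑ p ∈ R.filter (· ∉ positions B B N q s fun j => (L.getD (d j) (∅, 0)).1), W p
        ≤ β * ∑ p ∈ R, W p := by
  obtain ⟨s, hsn, hcard, hs⟩ := exists_split_card_le R B n
  obtain ⟨q, hq, hqT⟩ := exists_enum_of_card_le (R.filter (· < s)) B n
    (fun p hp => mem_range.1 (hR (mem_filter.1 hp).1)) hcard
  set K : ℕ → Finset ℕ := fun j => (range B).filter fun b => s + j * B + b ∈ R with hKdef
  have hex : ∀ j, ∃ d < L.length, Covers α β (L.getD d (∅, 0)).1 (L.getD d (∅, 0)).2 (K j) := by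
    intro j
    obtain ⟨e, he, hc⟩ := hL (K j) (filter_subset _ _)
    obtain ⟨d, hd, rfl⟩ := List.getElem_of_mem he
    exact ⟨d, hd, by rwa [List.getD_eq_getElem _ _ hd]⟩
  choose d hd hcov using hex
  set X : ℕ → Finset ℕ := fun j => (L.getD (d j) (∅, 0)).1 with hX
  set ℓ : ℕ → ℕ := fun j => (L.getD (d j) (∅, 0)).2 with hℓ
  refine ⟨q, s, d, hq, hsn, hd, ?_⟩
  change #(R.filter (· ∉ positions B B N q s X)) ≤ ∑ j ∈ range N, ℓ j ∧
      ∑ p ∈ (range n).filter (· ∈ positions B B N q s X), W p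
        + α * ∑ p ∈ R.filter (· ∉ positions B B N q s X), W p ≤ β * ∑ p ∈ R, W p
  set P := positions B B N q s X with hP
  have hRsub : R ⊆ range (s + N * B) := hR.trans (range_subset_range.2 (by omega))
  have hlow : ∀ p < s, p ∈ P ↔ p ∈ R := by
    intro p hp
    have h1 := hqT p (by omega)
    rw [mem_filter] at h1
    constructor
    · rintro (h | ⟨j, -, b, -, -, h⟩)
      · exact (h1.1 h).1
      · have : s ≤ s + j * B := Nat.le_add_right _ _
        omega
    · exact fun h => Or.inl (h1.2 ⟨h, hp⟩)
  -- The restriction to positions below `n` matters: the dummy guess `n` may coincide with a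
  -- position of a block. Weights vanish from `n` on, so nothing is lost.
  have hhigh : ∀ j < N, ∀ b < B, s + j * B + b < n → (s + j * B + b ∈ P ↔ b ∈ X j) := by
    intro j hj b hb hlt
    constructor
    · rintro (h | ⟨j', hj', b', hb', hmem, h⟩)
      · have := ((hqT _ hlt).1 h)
        rw [mem_filter] at this
        have h2 : s ≤ s + j * B := Nat.le_add_right _ _
        omega
      · have hjB : b' + B * j' = b + B * j := by rw [mul_comm B, mul_comm B]; omega
        have e1 : b' = b := by
          have := congrArg (· % B) hjB
          simpa [Nat.add_mul_mod_self_left, Nat.mod_eq_of_lt hb, Nat.mod_eq_of_lt hb'] using this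
        have hBpos : 0 < B := by omega
        have e2 : j' = j := by
          rw [e1] at hjB
          exact Nat.eq_of_mul_eq_mul_left hBpos (by omega)
        rw [← e1, ← e2]; exact hmem
    · exact fun h => Or.inr ⟨j, hj, b, hb, h, rfl⟩
  have hRhigh : ∀ j b, s + j * B + b ∈ R → s + j * B + b < n := fun j b h => mem_range.1 (hR h)
  constructor
  · have e : R.filter (· ∉ P) = (range (s + N * B)).filter fun p => p ∈ R ∧ p ∉ P := by
      ext p; simp only [mem_filter]
      exact ⟨fun h => ⟨hRsub h.1, h⟩, fun h => h.2⟩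
    rw [e, card_filter, sum_range_add_mul]
    have z : ∑ p ∈ range s, (if p ∈ R ∧ p ∉ P then 1 else 0) = 0 := by
      refine sum_eq_zero fun p hp => if_neg ?_
      rw [hlow p (mem_range.1 hp)]; tauto
    rw [z, zero_add]
    refine sum_le_sum fun j hj => ?_
    rw [← card_filter]
    refine le_trans (card_le_card ?_) (hcov j).1
    intro b hb
    rw [mem_filter, mem_range] at hb
    obtain ⟨hb, hbR, hbP⟩ := hb
    rw [mem_sdiff, hKdef, mem_filter, mem_range]
    exact ⟨⟨hb, hbR⟩, fun h => hbP ((hhigh j (mem_range.1 hj) b hb (hRhigh j b hbR)).2 h)⟩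
  · have e1 : ∑ p ∈ (range n).filter (· ∈ P), W p
        = ∑ p ∈ range (s + N * B), W p * (if p ∈ P then 1 else 0) := by
      rw [sum_filter]
      have : range n ⊆ range (s + N * B) := range_subset_range.2 (by omega)
      refine (sum_subset_zero_on_sdiff this ?_ ?_)
      · intro p hp
        rw [mem_sdiff, mem_range, mem_range] at hp
        rw [hWn p (by omega), zero_mul]
      · intro p _; split_ifs <;> simp
    have e2 : ∑ p ∈ R.filter (· ∉ P), W p
        = ∑ p ∈ range (s + N * B), W p * (if p ∈ R ∧ p ∉ P then 1 else 0) := by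
      have : R.filter (· ∉ P) = (range (s + N * B)).filter fun p => p ∈ R ∧ p ∉ P := by
        ext p; simp only [mem_filter]
        exact ⟨fun h => ⟨hRsub h.1, h⟩, fun h => h.2⟩
      rw [this, sum_filter]
      exact sum_congr rfl fun p _ => by split_ifs <;> simp
    have e3 : ∑ p ∈ R, W p = ∑ p ∈ range (s + N * B), W p * (if p ∈ R then 1 else 0) := by
      have : R = (range (s + N * B)).filter fun p => p ∈ R := by
        ext p; simp only [mem_filter]
        exact ⟨fun h => ⟨hRsub h, h⟩, fun h => h.2⟩
      conv_lhs => rw [this]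
      rw [sum_filter]
      exact sum_congr rfl fun p _ => by split_ifs <;> simp
    rw [← sub_nonpos, e1, e2, e3, mul_sum, mul_sum, ← sum_add_distrib, ← sum_sub_distrib]
    have e4 : ∀ p ∈ range (s + N * B), W p * (if p ∈ P then 1 else 0)
        + α * (W p * (if p ∈ R ∧ p ∉ P then 1 else 0)) - β * (W p * (if p ∈ R then 1 else 0))
        = W p * ((if p ∈ P then 1 else 0) + α * (if p ∈ R ∧ p ∉ P then 1 else 0)
          - β * (if p ∈ R then 1 else 0)) := fun p _ => by ring
    rw [sum_congr rfl e4, sum_range_add_mul]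
    -- Below `s` the chosen positions are exactly `R`, so each element of `R` there saves `(β - 1) W
    -- p ≥ (β - 1) W s`. There are `B` of them, unless `s = n` and then `W s = 0`. This saving pays
    -- for the telescoping block errors.
    have hlowsum : ∑ p ∈ range s, W p * ((if p ∈ P then 1 else 0)
        + α * (if p ∈ R ∧ p ∉ P then 1 else 0) - β * (if p ∈ R then 1 else 0))
        ≤ -((β - 1) * B * W s) := by
      have h1 : ∀ p ∈ range s, W p * ((if p ∈ P then 1 else 0)
          + α * (if p ∈ R ∧ p ∉ P then 1 else 0) - β * (if p ∈ R then 1 else 0))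
          ≤ -((β - 1) * W s) * (if p ∈ R then 1 else 0) := by
        intro p hp
        have hlt := mem_range.1 hp
        have hWs : W s ≤ W p := hW hlt.le
        by_cases h : p ∈ R
        · simp [h, (hlow p hlt).2 h]
          nlinarith [mul_le_mul_of_nonneg_left hWs (show 0 ≤ β - 1 by linarith)]
        · simp [h, (hlow p hlt).not.2 h]
      refine (sum_le_sum h1).trans ?_
      rw [← mul_sum, sum_boole]
      have h2 : ((range s).filter (· ∈ R)) = R.filter (· < s) := by
        ext p; simp only [mem_filter, mem_range]; tauto
      rw [h2]
      rcases hs with h | h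
      · rw [h]; apply le_of_eq; ring
      · rw [hWn s (by omega)]; simp
    have hblock : ∀ j ∈ range N, ∑ b ∈ range B, W (s + j * B + b)
        * ((if s + j * B + b ∈ P then 1 else 0)
          + α * (if s + j * B + b ∈ R ∧ s + j * B + b ∉ P then 1 else 0)
          - β * (if s + j * B + b ∈ R then 1 else 0))
        ≤ (β - 1) * B * (W (s + j * B) - W (s + (j + 1) * B)) := by
      intro j hj
      have := sum_block_le hα hβ hW hW0 (s + j * B) B (filter_subset _ _) (hcov j)
      rw [show s + (j + 1) * B = s + j * B + B by ring]
      refine le_trans (le_of_eq (sum_congr rfl fun b hb => ?_)) this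
      by_cases hlt : s + j * B + b < n
      · have h1 := hhigh j (mem_range.1 hj) b (mem_range.1 hb) hlt
        have h2 : b ∈ K j ↔ s + j * B + b ∈ R := by
          rw [hKdef, mem_filter]; simp [mem_range.1 hb]
        simp only [h1, ← h2]
        rfl
      · rw [hWn _ (not_lt.1 hlt), zero_mul, zero_mul]
    have htel : ∑ j ∈ range N, (β - 1) * B * (W (s + j * B) - W (s + (j + 1) * B))
        = (β - 1) * B * (W s - W (s + N * B)) := by
      rw [← mul_sum, Finset.sum_range_sub' (fun j => W (s + j * B)) N]
      simp
    have hfin := (sum_le_sum hblock).trans_eq htel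
    have : 0 ≤ (β - 1) * B * W (s + N * B) :=
      mul_nonneg (mul_nonneg (by linarith) (Nat.cast_nonneg _)) (hW0 _)
    linarith

end WSM

namespace WSM

open Finset

/-! ### Ranks -/

/-- The number of indices which precede `i` if the indices below `n` are sorted by decreasing
value of `u`, and by increasing index for equal values. -/
def rank (u : ℕ → ℕ) (n i : ℕ) : ℕ :=
  #((range n).filter fun j => u i < u j + if j < i then 1 else 0)

theorem rank_lt (u : ℕ → ℕ) {n i : ℕ} (hi : i < n) : rank u n i < n := by
  have : rank u n i < #(range n) := card_lt_card
    (filter_ssubset.2 ⟨i, mem_range.2 hi, by simp⟩)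
  rwa [card_range] at this

/-- The order with ties broken by index is strict and transitive: the predecessors of `i` also
precede `i'`, and `i` itself is an extra one. -/
theorem rank_lt_rank (u : ℕ → ℕ) {n i i' : ℕ} (hi : i < n)
    (h : u i' < u i + if i < i' then 1 else 0) : rank u n i < rank u n i' := by
  refine card_lt_card (Finset.ssubset_iff_subset_ne.2 ⟨?_, fun heq => ?_⟩)
  · intro j
    simp only [mem_filter, mem_range]
    rintro ⟨h1, h2⟩
    refine ⟨h1, ?_⟩
    split_ifs at * <;> omega
  · have h1 : i ∈ (range n).filter fun j => u i' < u j + if j < i' then 1 else 0 :=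
      mem_filter.2 ⟨mem_range.2 hi, h⟩
    rw [← heq, mem_filter] at h1
    simp at h1

theorem rank_trichotomy (u : ℕ → ℕ) {n i i' : ℕ} (hi : i < n) (hi' : i' < n) (hne : i ≠ i') :
    (rank u n i < rank u n i' ∧ u i' ≤ u i) ∨ (rank u n i' < rank u n i ∧ u i ≤ u i') := by
  by_cases h : u i' < u i + if i < i' then 1 else 0
  · exact Or.inl ⟨rank_lt_rank u hi h, by split_ifs at h <;> omega⟩
  · refine Or.inr ⟨rank_lt_rank u hi' ?_, ?_⟩ <;> split_ifs at * <;> omega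

theorem rank_injOn (u : ℕ → ℕ) {n i i' : ℕ} (hi : i < n) (hi' : i' < n)
    (h : rank u n i = rank u n i') : i = i' := by
  by_contra hne
  rcases rank_trichotomy u hi hi' hne with h1 | h1 <;> omega

theorem le_of_rank_le (u : ℕ → ℕ) {n i i' : ℕ} (hi : i < n) (hi' : i' < n)
    (h : rank u n i ≤ rank u n i') : u i' ≤ u i := by
  by_cases hne : i = i'
  · rw [hne]
  · rcases rank_trichotomy u hi hi' hne with h1 | h1 <;> omega

/-! ### Instances -/

theorem weight_union_le {n : ℕ} (w : Fin n → ℕ) (S T : Finset (Fin n)) :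
    weight w (S ∪ T) ≤ weight w S + weight w T := by
  have := Finset.sum_union_inter (s₁ := S) (s₂ := T) (f := w)
  unfold weight
  omega

theorem exists_weight_eq_opt {n : ℕ} (w : Fin n → ℕ) {F : Set (Finset (Fin n))}
    (hF : IsMonotone F) : ∃ T ∈ F, weight w T = opt w F := by
  obtain ⟨T, hT, h⟩ := Nat.sInf_mem (s := weight w '' F) ⟨_, _, hF.univ_mem, rfl⟩
  exact ⟨T, hT, h⟩

/-- The set which `L` prescribes for a block if the base `L.length` digits of the counter `V`
encode the choices for the blocks. -/
def blockSet (L : List (Finset ℕ × ℕ)) (V j : ℕ) : Finset ℕ :=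
  (L.getD (V / L.length ^ j % L.length) (∅, 0)).1

/-- The query size which `L` prescribes for a block. -/
def blockSize (L : List (Finset ℕ × ℕ)) (V j : ℕ) : ℕ :=
  (L.getD (V / L.length ^ j % L.length) (∅, 0)).2

/-- The number of blocks grows with `n` while the program text is fixed, so the choices for all
blocks are enumerated by one counter in base `D` instead of nested loops. -/
theorem exists_digits {D N : ℕ} (d : ℕ → ℕ) (hd : ∀ j, d j < D) :
    ∃ V < D ^ N, ∀ j < N, V / D ^ j % D = d j := by
  refine ⟨finFunctionFinEquiv (fun j : Fin N => (⟨d j, hd j⟩ : Fin D)), Fin.is_lt _, ?_⟩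
  intro j hj
  have := finFunctionFinEquiv_symm_apply_val
    (finFunctionFinEquiv (fun j : Fin N => (⟨d j, hd j⟩ : Fin D))) ⟨j, hj⟩
  rw [Equiv.symm_apply_apply] at this
  exact this.symm

/-- Expanding the power on the right gives one product of query costs per digit string, that is, per
counter value. -/
theorem sum_pow_blockSize (L : List (Finset ℕ × ℕ)) (c : ℝ) (N : ℕ) :
    ∑ V ∈ range (L.length ^ N), c ^ (∑ j ∈ range N, blockSize L V j)
      = (L.map fun e => c ^ e.2).sum ^ N := by
  have h1 : (L.map fun e => c ^ e.2).sum = ∑ d : Fin L.length, c ^ (L.getD d (∅, 0)).2 := by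
    rw [← List.sum_ofFn]
    congr 1
    apply List.ext_getElem
    · simp
    · intro i h h'
      simp at h
      simp
  rw [← Fin.sum_univ_eq_sum_range (fun V => c ^ (∑ j ∈ range N, blockSize L V j)),
    ← finFunctionFinEquiv.sum_comp, h1, Finset.sum_pow', Fintype.piFinset_univ]
  refine sum_congr rfl fun f _ => ?_
  rw [← Finset.prod_pow_eq_pow_sum, ← Fin.prod_univ_eq_prod_range
    (fun j => c ^ blockSize L (finFunctionFinEquiv f) j)]
  refine prod_congr rfl fun j _ => ?_
  have := finFunctionFinEquiv_symm_apply_val (finFunctionFinEquiv f) j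
  rw [Equiv.symm_apply_apply] at this
  rw [blockSize, ← this]

open Classical in
/-- The set of elements whose rank is among the chosen positions. -/
noncomputable def chosenSet {n : ℕ} (rk : ℕ → ℕ) (L : List (Finset ℕ × ℕ)) (B N : ℕ) (q : ℕ → ℕ)
    (s V : ℕ) : Finset (Fin n) :=
  univ.filter fun i => rk i ∈ positions B B N q s (blockSet L V)

theorem mem_chosenSet {n : ℕ} {rk : ℕ → ℕ} {L : List (Finset ℕ × ℕ)} {B N : ℕ} {q : ℕ → ℕ}
    {s V : ℕ} {i : Fin n} : i ∈ (chosenSet rk L B N q s V : Finset (Fin n)) ↔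
      rk i ∈ positions B B N q s (blockSet L V) := by
  simp [chosenSet]

/-- The size of the query for the counter `V`. -/
def querySize (L : List (Finset ℕ × ℕ)) (N V : ℕ) : ℕ := ∑ j ∈ range N, blockSize L V j

-- The position argument is transported along the bijection given by the ranks, with `R` the ranks
-- of an optimal solution `T`. As `T \ S` is an admissible extension of the chosen set `S`, the
-- oracle returns weight at most `α w(T \ S)`; adding `w(S)` gives at most `β w(T)`.
open Classical in
theorem exists_good_guess {α β : ℝ} (hα : 1 ≤ α) (hβ : 1 < β) {B : ℕ}
    {L : List (Finset ℕ × ℕ)} (hL : ∀ K ⊆ range B, ∃ e ∈ L, Covers α β e.1 e.2 K)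
    {n N : ℕ} (hN : n ≤ N * B) (w : Fin n → ℕ) (u : ℕ → ℕ) (hu : ∀ i : Fin n, u i = w i)
    {F : Set (Finset (Fin n))} (hF : IsMonotone F) {O : Finset (Fin n) → ℕ → Finset (Fin n)}
    (hO : IsExtensionOracle α w F O) :
    ∃ (q : ℕ → ℕ) (s V : ℕ), (∀ j, q j ≤ n) ∧ s ≤ n ∧ V < L.length ^ N ∧
      (weight w (O (chosenSet (rank u n) L B N q s V) (querySize L N V)
        ∪ chosenSet (rank u n) L B N q s V) : ℝ) ≤ β * opt w F := by
  obtain ⟨T, hTF, hTopt⟩ := exists_weight_eq_opt w hF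
  have hinj : Function.Injective fun i : Fin n => (⟨rank u n i, rank_lt u i.2⟩ : Fin n) :=
    fun i i' h => Fin.ext (rank_injOn u i.2 i'.2 (Fin.mk.inj_iff.1 h))
  let e : Fin n ≃ Fin n := Equiv.ofBijective _ (Finite.injective_iff_bijective.1 hinj)
  have he : ∀ i, (e i : ℕ) = rank u n i := fun i => rfl
  -- Padding by zero keeps `W` antitone and lets the blocks overrun the end of the list.
  let W : ℕ → ℝ := fun p => if h : p < n then (w (e.symm ⟨p, h⟩) : ℝ) else 0
  have hWrank : ∀ i : Fin n, W (rank u n i) = w i := by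
    intro i
    have h1 : (⟨rank u n i, rank_lt u i.2⟩ : Fin n) = e i := rfl
    simp only [W, dif_pos (rank_lt u i.2), h1, Equiv.symm_apply_apply]
  have hW : Antitone W := by
    intro p p' hpp
    by_cases h' : p' < n
    · have h : p < n := by omega
      simp only [W, dif_pos h, dif_pos h']
      have h1 := he (e.symm ⟨p, h⟩)
      have h2 := he (e.symm ⟨p', h'⟩)
      rw [Equiv.apply_symm_apply] at h1 h2
      have := le_of_rank_le u (e.symm ⟨p, h⟩).2 (e.symm ⟨p', h'⟩).2 (n := n)
        (by rw [← h1, ← h2]; exact hpp)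
      rw [hu, hu] at this
      exact_mod_cast this
    · simp only [W, dif_neg h']
      split_ifs <;> positivity
  have hW0 : ∀ p, 0 ≤ W p := fun p => by simp only [W]; split_ifs <;> positivity
  have hWn : ∀ p, n ≤ p → W p = 0 := fun p hp => by simp only [W, dif_neg (not_lt.2 hp)]
  have hrinj : Function.Injective fun i : Fin n => rank u n i :=
    fun i i' h => Fin.ext (rank_injOn u i.2 i'.2 h)
  have hsumW : ∀ Z : Finset (Fin n),
      ∑ p ∈ Z.image (fun i : Fin n => rank u n i), W p = weight w Z := by
    intro Z
    rw [sum_image fun i _ i' _ h => hrinj h, weight, Nat.cast_sum]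
    exact sum_congr rfl fun i _ => hWrank i
  have hR : T.image (fun i : Fin n => rank u n i) ⊆ range n := by
    intro p hp
    obtain ⟨i, -, rfl⟩ := mem_image.1 hp
    exact mem_range.2 (rank_lt u i.2)
  obtain ⟨q, s, d, hq, hs, hd, hcard, hsum⟩ := exists_good_positions hα hβ hL hN hW hW0 hWn hR
  obtain ⟨V, hV, hVd⟩ := exists_digits (N := N) d hd
  refine ⟨q, s, V, hq, hs, hV, ?_⟩
  have hpos : (positions B B N q s fun j => (L.getD (d j) (∅, 0)).1)
      = positions B B N q s (blockSet L V) := by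
    ext p
    simp only [positions, Set.mem_ofPred_eq, blockSet]
    refine or_congr_right (exists_congr fun j => and_congr_right fun hj => ?_)
    rw [hVd j hj]
  have hℓ : ∑ j ∈ range N, (L.getD (d j) (∅, 0)).2 = querySize L N V :=
    sum_congr rfl fun j hj => by rw [blockSize, hVd j (mem_range.1 hj)]
  rw [hpos, hℓ] at hcard
  rw [hpos] at hsum
  set S : Finset (Fin n) := chosenSet (rank u n) L B N q s V with hS
  have hmem : ∀ i : Fin n, i ∈ S ↔ rank u n i ∈ positions B B N q s (blockSet L V) :=
    fun i => mem_chosenSet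
  have e1 : (range n).filter (· ∈ positions B B N q s (blockSet L V))
      = S.image (fun i : Fin n => rank u n i) := by
    ext p
    simp only [mem_filter, mem_range, mem_image]
    constructor
    · rintro ⟨hp, hpP⟩
      have h1 := he (e.symm ⟨p, hp⟩)
      rw [Equiv.apply_symm_apply] at h1
      simp only at h1
      exact ⟨e.symm ⟨p, hp⟩, (hmem _).2 (h1 ▸ hpP), h1.symm⟩
    · rintro ⟨i, hi, rfl⟩
      exact ⟨rank_lt u i.2, (hmem i).1 hi⟩
  have e2 : (T.image (fun i : Fin n => rank u n i)).filter
      (· ∉ positions B B N q s (blockSet L V)) = (T \ S).image (fun i : Fin n => rank u n i) := by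
    ext p
    simp only [mem_filter, mem_image, mem_sdiff]
    constructor
    · rintro ⟨⟨i, hi, rfl⟩, h⟩
      exact ⟨i, ⟨hi, fun h' => h ((hmem i).1 h')⟩, rfl⟩
    · rintro ⟨i, ⟨hi, hiS⟩, rfl⟩
      exact ⟨⟨i, hi, rfl⟩, fun h' => hiS ((hmem i).2 h')⟩
  rw [e2, card_image_of_injective _ hrinj] at hcard
  rw [e1, e2, hsumW, hsumW, hsumW, hTopt] at hsum
  have hor := hO.weight_le S (querySize L N V) (T \ S) hcard
    (hF.mem_of_subset T _ (fun i hi => by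
      by_cases h : i ∈ S <;> simp [h, hi]) hTF)
  have hun : (weight w (O S (querySize L N V) ∪ S) : ℝ)
      ≤ weight w (O S (querySize L N V)) + weight w S := by
    exact_mod_cast weight_union_le w _ _
  linarith

end WSM

/-! ### Reasoning about programs and their running time. -/

namespace WSM

open Finset

/-! ### A program logic for total correctness with time bounds -/

/-- `P` started in `σ` halts within time `T` in a state which satisfies `Q`. -/
def Runs {n : ℕ} (O : Finset (Fin n) → ℕ → Finset (Fin n)) (c : ℝ) (P : Program) (σ : State)
    (T : ℝ) (Q : State → Prop) : Prop :=
  ∃ σ' t, Exec O c P σ σ' t ∧ t ≤ T ∧ Q σ'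

/-- The registers which occur as targets of assignments. -/
def Program.WritesReg : Program → ℕ → Prop
  | .skip, _ => False
  | .assign y _, x => x = y
  | .store _ _ _, _ => False
  | .query _ _ _, _ => False
  | .seq P Q, x => P.WritesReg x ∨ Q.WritesReg x
  | .ite _ P Q, x => P.WritesReg x ∨ Q.WritesReg x
  | .loop _ P, x => P.WritesReg x

/-- The arrays which occur as targets of stores and queries. -/
def Program.WritesArr : Program → ℕ → Prop
  | .skip, _ => False
  | .assign _ _, _ => False
  | .store b _ _, a => a = b
  | .query _ _ b, a => a = b
  | .seq P Q, a => P.WritesArr a ∨ Q.WritesArr a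
  | .ite _ P Q, a => P.WritesArr a ∨ Q.WritesArr a
  | .loop _ P, a => P.WritesArr a

/-- `σ'` agrees with `σ` on everything that `P` does not write to. -/
structure Agree (P : Program) (σ σ' : State) : Prop where
  reg : ∀ x, ¬ P.WritesReg x → σ'.reg x = σ.reg x
  arr : ∀ a, ¬ P.WritesArr a → σ'.arr a = σ.arr a

@[simp] theorem reg_setReg (σ : State) (x v y : ℕ) :
    (σ.setReg x v).reg y = if y = x then v else σ.reg y := by
  simp [State.setReg, Function.update_apply]

@[simp] theorem arr_setReg (σ : State) (x v : ℕ) : (σ.setReg x v).arr = σ.arr := rfl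

@[simp] theorem reg_setCell (σ : State) (a i v : ℕ) : (σ.setCell a i v).reg = σ.reg := rfl

@[simp] theorem arr_setCell (σ : State) (a i v b j : ℕ) :
    (σ.setCell a i v).arr b j = if b = a ∧ j = i then v else σ.arr b j := by
  by_cases hb : b = a
  · subst hb
    simp [State.setCell, Function.update_apply]
  · simp [State.setCell, hb]

theorem Agree.refl (P : Program) (σ : State) : Agree P σ σ := ⟨fun _ _ => rfl, fun _ _ => rfl⟩

theorem Agree.trans {P : Program} {σ₁ σ₂ σ₃ : State} (h : Agree P σ₁ σ₂) (h' : Agree P σ₂ σ₃) :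
    Agree P σ₁ σ₃ :=
  ⟨fun x hx => (h'.reg x hx).trans (h.reg x hx), fun a ha => (h'.arr a ha).trans (h.arr a ha)⟩

theorem Agree.mono {P P' : Program} {σ σ' : State} (h : Agree P σ σ')
    (hr : ∀ x, P.WritesReg x → P'.WritesReg x) (ha : ∀ a, P.WritesArr a → P'.WritesArr a) :
    Agree P' σ σ' :=
  ⟨fun x hx => h.reg x fun h' => hx (hr x h'), fun a hx => h.arr a fun h' => hx (ha a h')⟩

/-- The frame rule: specifications need only mention what a program changes, and everything else is
preserved for syntactic reasons. -/
theorem Exec.agree {n : ℕ} {O : Finset (Fin n) → ℕ → Finset (Fin n)} {c : ℝ} {P : Program}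
    {σ σ' : State} {t : ℝ} (h : Exec O c P σ σ' t) : Agree P σ σ' := by
  induction h with
  | skip => exact Agree.refl _ _
  | assign σ x e => exact ⟨fun y hy => by simp [show y ≠ x from hy], fun _ _ => rfl⟩
  | store σ a i e =>
    refine ⟨fun _ _ => rfl, fun b hb => ?_⟩
    have : b ≠ a := hb
    simp [State.setCell, this]
  | query σ s ℓ x =>
    refine ⟨fun _ _ => rfl, fun b hb => ?_⟩
    have : b ≠ x := hb
    simp [State.setSet, this]
  | seq _ _ ih₁ ih₂ =>
    exact (ih₁.mono (fun _ => Or.inl) fun _ => Or.inl).trans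
      (ih₂.mono (fun _ => Or.inr) fun _ => Or.inr)
  | ite_true _ _ ih => exact ih.mono (fun _ => Or.inl) fun _ => Or.inl
  | ite_false _ _ ih => exact ih.mono (fun _ => Or.inr) fun _ => Or.inr
  | loop_true _ _ _ ih₁ ih₂ => exact Agree.trans ⟨ih₁.reg, ih₁.arr⟩ ih₂
  | loop_false => exact Agree.refl _ _

section

variable {n : ℕ} {O : Finset (Fin n) → ℕ → Finset (Fin n)} {c : ℝ}

namespace Runs

theorem mono {P : Program} {σ : State} {T T' : ℝ} {Q Q' : State → Prop} (h : Runs O c P σ T Q)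
    (hT : T ≤ T') (hQ : ∀ σ', Q σ' → Q' σ') : Runs O c P σ T' Q' := by
  obtain ⟨σ', t, he, ht, hq⟩ := h
  exact ⟨σ', t, he, ht.trans hT, hQ σ' hq⟩

theorem frame {P : Program} {σ : State} {T : ℝ} {Q : State → Prop} (h : Runs O c P σ T Q) :
    Runs O c P σ T fun σ' => Q σ' ∧ Agree P σ σ' := by
  obtain ⟨σ', t, he, ht, hq⟩ := h
  exact ⟨σ', t, he, ht, hq, he.agree⟩

theorem skip {σ : State} {Q : State → Prop} (h : Q σ) : Runs O c .skip σ 1 Q :=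
  ⟨_, _, .skip σ, le_rfl, h⟩

theorem assign {σ : State} {x : ℕ} {e : Expr} {Q : State → Prop}
    (h : Q (σ.setReg x (e.eval σ))) : Runs O c (.assign x e) σ (e.steps + 1) Q :=
  ⟨_, _, .assign σ x e, le_rfl, h⟩

theorem store {σ : State} {a : ℕ} {i e : Expr} {Q : State → Prop}
    (h : Q (σ.setCell a (i.eval σ) (e.eval σ))) :
    Runs O c (.store a i e) σ (i.steps + e.steps + 1) Q :=
  ⟨_, _, .store σ a i e, le_rfl, h⟩

theorem query {σ : State} {s x : ℕ} {ℓ : Expr} {Q : State → Prop}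
    (h : Q (σ.setSet x (O (σ.getSet n s) (ℓ.eval σ)))) :
    Runs O c (.query s ℓ x) σ (ℓ.steps + 1 + c ^ ℓ.eval σ) Q :=
  ⟨_, _, .query σ s ℓ x, le_rfl, h⟩

theorem seq {P P' : Program} {σ : State} {T T' : ℝ} {R Q : State → Prop}
    (h : Runs O c P σ T R) (h' : ∀ σ', R σ' → Runs O c P' σ' T' Q) :
    Runs O c (.seq P P') σ (T + T') Q := by
  obtain ⟨σ', t, he, ht, hr⟩ := h
  obtain ⟨σ'', t', he', ht', hq⟩ := h' σ' hr
  exact ⟨σ'', t + t', .seq he he', add_le_add ht ht', hq⟩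

theorem ite {e : Expr} {P P' : Program} {σ : State} {T : ℝ} {Q : State → Prop}
    (h : e.eval σ ≠ 0 → Runs O c P σ T Q) (h' : e.eval σ = 0 → Runs O c P' σ T Q) :
    Runs O c (.ite e P P') σ (e.steps + 1 + T) Q := by
  by_cases he : e.eval σ = 0
  · obtain ⟨σ', t, hx, ht, hq⟩ := h' he
    exact ⟨σ', _, .ite_false he hx, by gcongr, hq⟩
  · obtain ⟨σ', t, hx, ht, hq⟩ := h he
    exact ⟨σ', _, .ite_true he hx, by gcongr, hq⟩

theorem loop {e : Expr} {P : Program} (I : ℕ → State → Prop) (T : ℕ → ℝ) {m : ℕ} {σ : State}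
    (h0 : I 0 σ) (hstep : ∀ k < m, ∀ σ, I k σ → e.eval σ ≠ 0 ∧ Runs O c P σ (T k) (I (k + 1)))
    (hend : ∀ σ, I m σ → e.eval σ = 0) :
    Runs O c (.loop e P) σ (∑ k ∈ range m, (T k + (e.steps + 1)) + (e.steps + 1)) (I m) := by
  suffices H : ∀ j k, k + j = m → ∀ σ, I k σ → Runs O c (.loop e P) σ
      (∑ i ∈ range j, (T (k + i) + (e.steps + 1)) + (e.steps + 1)) (I m) by
    simpa using H m 0 (by omega) σ h0
  intro j
  induction j with
  | zero =>
    rintro k rfl σ hσ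
    exact ⟨σ, _, .loop_false (hend σ hσ), by simp, hσ⟩
  | succ j ih =>
    intro k hk σ hσ
    obtain ⟨he, σ', t, hx, ht, hq⟩ := hstep k (by omega) σ hσ
    obtain ⟨σ'', t', hx', ht', hq'⟩ := ih (k + 1) (by omega) σ' hq
    refine ⟨σ'', _, .loop_true he hx hx', ?_, hq'⟩
    rw [sum_range_succ']
    have e1 : ∀ i, k + 1 + i = k + (i + 1) := fun i => by omega
    simp only [e1] at ht'
    simp only [add_zero]
    linarith

end Runs

/-- `for i = 0, …, m - 1`. -/
def forP (i : ℕ) (m : Expr) (P : Program) : Program :=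
  .seq (.assign i (.const 0)) (.loop (.sub m (.reg i))
    (.seq P (.assign i (.add (.reg i) (.const 1)))))

@[simp] theorem writesReg_forP (i : ℕ) (m : Expr) (P : Program) (x : ℕ) :
    (forP i m P).WritesReg x ↔ x = i ∨ P.WritesReg x := by
  simp [forP, Program.WritesReg, or_comm]

@[simp] theorem writesArr_forP (i : ℕ) (m : Expr) (P : Program) (a : ℕ) :
    (forP i m P).WritesArr a ↔ P.WritesArr a := by
  simp [forP, Program.WritesArr]

/-- The bound `m` is evaluated anew in every round, so its value must be stable under whatever the
loop writes. Each test costs `m.steps + 3` and each increment `4`; the final test and the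
initialization give the last summand. -/
theorem Runs.forP {i : ℕ} {m : Expr} {P : Program} (I : ℕ → State → Prop) (T : ℕ → ℝ) {M : ℕ}
    {σ : State} (hI : ∀ k σ v, I k σ → I k (σ.setReg i v)) (h0 : I 0 σ)
    (hP : ¬ P.WritesReg i) (hm : ∀ σ', Agree (WSM.forP i m P) σ σ' → m.eval σ' = M)
    (hstep : ∀ k < M, ∀ σ', Agree (WSM.forP i m P) σ σ' → σ'.reg i = k → I k σ' →
      Runs O c P σ' (T k) (I (k + 1))) :
    Runs O c (WSM.forP i m P) σ (∑ k ∈ range M, (T k + (m.steps + 7)) + (m.steps + 5)) (I M) := by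
  have hag : ∀ σ v, Agree (WSM.forP i m P) σ (σ.setReg i v) := fun σ v =>
    ⟨fun x hx => by
      have : x ≠ i := fun h => hx (by simp [h])
      simp [this], fun _ _ => rfl⟩
  have key := Runs.seq (O := O) (c := c) (P := .assign i (.const 0)) (σ := σ)
    (P' := .loop (.sub m (.reg i)) (.seq P (.assign i (.add (.reg i) (.const 1)))))
    (R := fun σ' => I 0 σ' ∧ σ'.reg i = 0 ∧ Agree (WSM.forP i m P) σ σ')
    (Q := fun σ' => I M σ' ∧ σ'.reg i = M ∧ Agree (WSM.forP i m P) σ σ')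
    (Runs.assign ⟨hI _ _ _ h0, by simp [Expr.eval], hag _ _⟩) (fun σ' hσ' =>
      Runs.loop (fun k σ' => I k σ' ∧ σ'.reg i = k ∧ Agree (WSM.forP i m P) σ σ')
        (fun k => T k + 4) (m := M) hσ' (by
          rintro k hk σ₁ ⟨h1, h2, h3⟩
          refine ⟨by simp [Expr.eval, hm σ₁ h3, h2]; omega, ?_⟩
          refine Runs.mono (Runs.seq (hstep k hk σ₁ h3 h2 h1).frame fun σ₂ h => Runs.assign
            (Q := fun σ' => I (k + 1) σ' ∧ σ'.reg i = k + 1 ∧ Agree (WSM.forP i m P) σ σ') ?_)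
            ?_ fun _ h => h
          · obtain ⟨h4, h5⟩ := h
            have h6 : σ₂.reg i = k := by rw [h5.reg i hP, h2]
            refine ⟨hI _ _ _ h4, by simp [Expr.eval, h6], (h3.trans (h5.mono ?_ ?_)).trans (hag _ _)⟩
            · intro x hx; simp [hx]
            · intro x hx; simp [hx]
          · simp [Expr.steps]; norm_num) (by
          rintro σ₁ ⟨h1, h2, h3⟩
          simp [Expr.eval, hm σ₁ h3, h2]))
  refine key.mono (le_of_eq ?_) fun _ h => h.1
  simp only [Expr.steps]
  push_cast
  have : ∀ k, T k + 4 + ((m.steps : ℝ) + 1 + 1 + 1) = T k + (m.steps + 7) := fun k => by ring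
  simp only [this]
  ring

/-- The time bound of a loop over `0, …, n - 1` whose body takes constant time. -/
theorem Runs.forP_const {i : ℕ} {P : Program} (I : ℕ → State → Prop) {T : ℝ} {M : ℕ}
    {σ : State} (hI : ∀ k σ v, I k σ → I k (σ.setReg i v)) (h0 : I 0 σ)
    (hP : ¬ P.WritesReg i) (hP0 : ¬ (WSM.forP i (.reg 0) P).WritesReg 0) (hm : σ.reg 0 = M)
    (hT : 0 ≤ T) (hstep : ∀ k < M, ∀ σ', Agree (WSM.forP i (.reg 0) P) σ σ' → σ'.reg i = k →
      I k σ' → Runs O c P σ' T (I (k + 1))) :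
    Runs O c (WSM.forP i (.reg 0) P) σ ((T + 8) * (M + 1)) (I M) := by
  refine (Runs.forP I (fun _ => T) hI h0 hP (fun σ' h => by rw [Expr.eval, h.reg 0 hP0, hm])
    hstep).mono ?_ fun _ h => h
  simp [Expr.steps]
  nlinarith

/-! ### Expressions -/

/-- `k * e`. -/
def Expr.mul (e : Expr) : ℕ → Expr
  | 0 => .const 0
  | k + 1 => .add (e.mul k) e

@[simp] theorem Expr.eval_mul (σ : State) (e : Expr) (k : ℕ) :
    (e.mul k).eval σ = k * e.eval σ := by
  induction k with
  | zero => simp [Expr.mul, Expr.eval]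
  | succ k ih => simp [Expr.mul, Expr.eval, ih, Nat.succ_mul]

/-- The value `f v`, where `v < D` is the value of `e`. -/
def Expr.lookup (f : ℕ → ℕ) (e : Expr) : ℕ → Expr
  | 0 => .const 0
  | D + 1 => .add (e.lookup f D)
      ((Expr.sub (.const 1) (.add (.sub e (.const D)) (.sub (.const D) e))).mul (f D))

/-- With truncated subtraction `(e - D) + (D - e)` is the distance of `e` and `D`, so `1` minus it
is the indicator of equality. This hardwires a finite table into an expression. -/
theorem Expr.eval_lookup (σ : State) (f : ℕ → ℕ) (e : Expr) (D : ℕ) :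
    (e.lookup f D).eval σ = if e.eval σ < D then f (e.eval σ) else 0 := by
  induction D with
  | zero => simp [Expr.lookup, Expr.eval]
  | succ D ih =>
    simp only [Expr.lookup, Expr.eval, ih, Expr.eval_mul]
    rcases lt_trichotomy (e.eval σ) D with h | h | h
    · rw [if_pos h, if_pos (by omega), show 1 - (e.eval σ - D + (D - e.eval σ)) = 0 by omega]; simp
    · rw [h]; simp
    · rw [if_neg (by omega), if_neg (by omega),
        show 1 - (e.eval σ - D + (D - e.eval σ)) = 0 by omega]; simp

end

end WSM

/-! ### The pieces of the program, with their correctness and running time. -/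

namespace WSM

open Finset

variable {n : ℕ} {O : Finset (Fin n) → ℕ → Finset (Fin n)} {c : ℝ}

/-! ### Preparation: ranks, the initial solution, and powers -/

/-- Whether index `reg 2` precedes index `reg 1` in the order by decreasing weight. -/
def precedesE : Expr :=
  .sub (.const 1) (.sub (.const 1) (.sub
    (.add (.arr 0 (.reg 2)) (.sub (.const 1) (.sub (.const 1) (.sub (.reg 1) (.reg 2)))))
    (.arr 0 (.reg 1))))

/-- The form `1 - (1 - t)` turns a positive `t` into `1` and keeps `0`. -/
theorem eval_precedesE (σ : State) : precedesE.eval σ =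
    if σ.arr 0 (σ.reg 1) < σ.arr 0 (σ.reg 2) + (if σ.reg 2 < σ.reg 1 then 1 else 0)
      then 1 else 0 := by
  simp only [precedesE, Expr.eval]
  split_ifs <;> omega

/-- Store the ranks of the elements in array `2`. -/
def rankP : Program :=
  forP 1 (.reg 0) (.seq (.assign 3 (.const 0)) (.seq
    (forP 2 (.reg 0) (.assign 3 (.add (.reg 3) precedesE))) (.store 2 (.reg 1) (.reg 3))))

theorem runs_rankP {σ : State} {m : ℕ} (h0 : σ.reg 0 = m) :
    Runs O c rankP σ ((28 * (m + 1) + 13) * (m + 1))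
      fun σ' => ∀ i < m, σ'.arr 2 i = rank (σ.arr 0) m i := by
  refine (Runs.forP_const (fun k σ' => ∀ i < k, σ'.arr 2 i = rank (σ.arr 0) m i)
    (T := 2 + (28 * (m + 1) + 3)) (fun k σ v h => h) (by simp) (by simp [Program.WritesReg])
    (by simp [Program.WritesReg]) h0 (by positivity) ?_).mono (by nlinarith) fun _ h => h
  intro k hk σ₁ hag h1 hinv
  have hn : σ₁.reg 0 = m := by rw [hag.reg 0 (by simp [Program.WritesReg]), h0]
  have hw : σ₁.arr 0 = σ.arr 0 := hag.arr 0 (by simp [Program.WritesArr])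
  refine (Runs.seq (T' := 28 * (m + 1) + 3)
    (Runs.frame (Runs.assign (Q := fun σ' => σ'.reg 3 = 0) (by simp [Expr.eval])))
    fun σ₂ h2 => ?_).mono (by simp [Expr.steps]; norm_num) fun _ h => h
  obtain ⟨h3, hag2⟩ := h2
  have hn2 : σ₂.reg 0 = m := by rw [hag2.reg 0 (by simp [Program.WritesReg]), hn]
  have h12 : σ₂.reg 1 = k := by rw [hag2.reg 1 (by simp [Program.WritesReg]), h1]
  have ha2 : σ₂.arr = σ₁.arr := funext fun a => hag2.arr a (by simp [Program.WritesArr])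
  refine (Runs.seq (Runs.frame (Runs.forP_const
    (fun j σ' => σ'.reg 3 = #((range j).filter fun j =>
      σ.arr 0 k < σ.arr 0 j + if j < k then 1 else 0))
    (T := 20) (fun j σ v h => by simpa using h) (by simpa using h3) (by simp [Program.WritesReg])
    (by simp [Program.WritesReg]) hn2 (by norm_num) ?_)) fun σ₃ h => Runs.store ?_).mono
    ?_ fun _ h => h
  · intro j hj σ₃ hag3 hr hinv3
    refine (Runs.assign ?_).mono (by simp [Expr.steps, precedesE]; norm_num) fun _ h => h
    have e1 : σ₃.reg 1 = k := by rw [hag3.reg 1 (by simp [Program.WritesReg]), h12]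
    have e2 : σ₃.arr 0 = σ.arr 0 := by
      rw [hag3.arr 0 (by simp [Program.WritesArr]), ha2, hw]
    simp only [Expr.eval, eval_precedesE, reg_setReg, if_true, e1, e2, hr, hinv3]
    rw [range_add_one, filter_insert]
    split_ifs <;> simp
  · obtain ⟨h4, hag3⟩ := h
    have e1 : σ₃.reg 1 = k := by rw [hag3.reg 1 (by simp [Program.WritesReg]), h12]
    have e2 : σ₃.arr 2 = σ₁.arr 2 := by
      rw [hag3.arr 2 (by simp [Program.WritesArr]), ha2]
    intro i hi
    simp only [arr_setCell, Expr.eval, e1, e2, true_and]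
    split_ifs with hik
    · rw [h4, hik, rank]
    · exact hinv i (by omega)
  · simp [Expr.steps]; nlinarith

/-- Store the full set in array `1` and its weight in register `4`. -/
def initP : Program :=
  forP 1 (.reg 0) (.seq (.store 1 (.reg 1) (.const 1))
    (.assign 4 (.add (.reg 4) (.arr 0 (.reg 1)))))

theorem runs_initP {σ : State} {m : ℕ} (h0 : σ.reg 0 = m) (h4 : σ.reg 4 = 0) :
    Runs O c initP σ (16 * (m + 1)) fun σ' =>
      (∀ i < m, σ'.arr 1 i = 1) ∧ σ'.reg 4 = ∑ i ∈ range m, σ.arr 0 i := by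
  refine (Runs.forP_const (fun k σ' => (∀ i < k, σ'.arr 1 i = 1) ∧
    σ'.reg 4 = ∑ i ∈ range k, σ.arr 0 i) (T := 8) (fun k σ v h => by simpa using h)
    (by simpa using h4) (by simp [Program.WritesReg])
    (by simp [Program.WritesReg]) h0 (by positivity) ?_).mono (by nlinarith) fun _ h => h
  intro k hk σ₁ hag h1 hinv
  refine (Runs.seq (Runs.store (Q := fun σ' => σ' = σ₁.setCell 1 k 1)
    (by simp [Expr.eval, h1])) fun σ₂ h2 => Runs.assign ?_).mono
    (by simp [Expr.steps]; norm_num) fun _ h => h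
  subst h2
  have hw : σ₁.arr 0 = σ.arr 0 := hag.arr 0 (by simp [Program.WritesArr])
  constructor
  · intro i hi
    simp only [arr_setReg, arr_setCell, true_and]
    split_ifs with hik
    · rfl
    · exact hinv.1 i (by omega)
  · simp [Expr.eval, h1, hw, hinv.2, sum_range_succ]

/-- Compute the number `N = ⌈n / B⌉` of blocks in register `5` and the powers `D ^ j`, `j ≤ N`,
in array `3`. -/
def powP (B D : ℕ) : Program :=
  .seq (.store 3 (.const 0) (.const 1)) (.seq (.assign 9 (.reg 0)) (.loop (.reg 9)
    (.seq (.store 3 (.add (.reg 5) (.const 1)) ((Expr.arr 3 (.reg 5)).mul D))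
      (.seq (.assign 5 (.add (.reg 5) (.const 1))) (.assign 9 (.sub (.reg 9) (.const B)))))))

/-- Truncated subtraction of `B` from `n` reaches zero after exactly `⌈n / B⌉` rounds.
Multiplication by the constant `D` is a repeated addition, whose length enters `K` but does not
depend on `n`. -/
theorem exists_runs_powP (B D : ℕ) (hB : 0 < B) : ∃ K : ℝ, 0 ≤ K ∧
    ∀ (n : ℕ) (O : Finset (Fin n) → ℕ → Finset (Fin n)) (c : ℝ) (σ : State) (m : ℕ),
      σ.reg 0 = m → σ.reg 5 = 0 → Runs O c (powP B D) σ (K * (m + 1)) fun σ' =>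
        σ'.reg 5 = (m + B - 1) / B ∧ ∀ j ≤ (m + B - 1) / B, σ'.arr 3 j = D ^ j := by
  set E := (Expr.arr 3 (.reg 5)).mul D with hE
  refine ⟨E.steps + 20, by positivity, fun n O c σ m h0 h5 => ?_⟩
  set N := (m + B - 1) / B with hN
  have hN1 : m ≤ N * B := by
    have h1 := Nat.div_add_mod (m + B - 1) B
    have h2 := Nat.mod_lt (m + B - 1) hB
    rw [← hN] at h1
    rw [mul_comm]; omega
  have hN2 : ∀ k < N, k * B < m := by
    intro k hk
    have h1 : (k + 1) * B ≤ m + B - 1 := (Nat.le_div_iff_mul_le hB).1 hk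
    rw [Nat.succ_mul] at h1; omega
  have hN3 : N ≤ m := by
    by_contra h
    have := hN2 m (by omega)
    nlinarith
  refine (Runs.seq (Runs.store (Q := fun σ' => σ' = σ.setCell 3 0 1) (by simp [Expr.eval]))
    fun σ₁ h1 => Runs.seq (Runs.assign (Q := fun σ' => σ' = σ₁.setReg 9 m)
      (by subst h1; simp [Expr.eval, h0])) fun σ₂ h2 => Runs.loop (m := N)
      (fun k σ' => σ'.reg 5 = k ∧ σ'.reg 9 = m - k * B ∧ ∀ j ≤ k, σ'.arr 3 j = D ^ j)
      (fun _ => E.steps + 12) ?_ ?_ ?_).mono ?_ fun σ' h => ⟨h.1, h.2.2⟩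
  · subst h2 h1
    refine ⟨by simp [h5], by simp, fun j hj => ?_⟩
    obtain rfl : j = 0 := by omega
    simp
  · rintro k hk σ₃ ⟨a1, a2, a3⟩
    have := hN2 k hk
    refine ⟨by simp [Expr.eval, a2]; omega, ?_⟩
    refine (Runs.seq (Runs.store (Q := fun σ' => σ' = σ₃.setCell 3 (k + 1) (D ^ (k + 1)))
      (by simp [Expr.eval, a1, a3 k le_rfl, pow_succ, mul_comm]))
      fun σ₄ h4 => Runs.seq (Runs.assign (Q := fun σ' => σ' = σ₄.setReg 5 (k + 1))
      (by subst h4; simp [Expr.eval, a1])) fun σ₅ h5 => Runs.assign ?_).mono ?_ fun _ h => h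
    · subst h5 h4
      refine ⟨by simp, ?_, fun j hj => ?_⟩
      · simp [Expr.eval, a2, Nat.succ_mul]; omega
      · simp only [arr_setReg, arr_setCell, true_and]
        split_ifs with h
        · rw [h]
        · exact a3 j (by omega)
    · simp only [Expr.steps]; push_cast; linarith
  · rintro σ₃ ⟨-, a2, -⟩
    simp [Expr.eval, a2]; omega
  · have hN3' : (N : ℝ) ≤ m := by exact_mod_cast hN3
    have : (0 : ℝ) ≤ E.steps := by positivity
    simp [Expr.steps]
    nlinarith [mul_le_mul_of_nonneg_right hN3' this]

end WSM

namespace WSM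

open Finset

variable {n : ℕ} {O : Finset (Fin n) → ℕ → Finset (Fin n)} {c : ℝ}

/-! ### The set of positions of a guess -/

/-- Clear the first `n` cells of array `4`. -/
def clearP : Program := forP 1 (.reg 0) (.store 4 (.reg 1) (.const 0))

/-- Cells from `n` on may keep marks left by dummy guesses or by an overrunning block; they are
harmless, because only cells indexed by ranks are read. -/
theorem runs_clearP {σ : State} {m : ℕ} (h0 : σ.reg 0 = m) :
    Runs O c clearP σ (11 * (m + 1)) fun σ' => ∀ p < m, σ'.arr 4 p = 0 := by
  refine (Runs.forP_const (fun k σ' => ∀ p < k, σ'.arr 4 p = 0) (T := 3) (fun k σ v h => h)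
    (by simp) (by simp [Program.WritesReg]) (by simp [Program.WritesReg]) h0 (by positivity)
    ?_).mono (by nlinarith) fun _ h => h
  intro k hk σ₁ hag h1 hinv
  refine (Runs.store ?_).mono (by simp [Expr.steps]; norm_num) fun _ h => h
  intro p hp
  simp only [arr_setCell, Expr.eval, h1, true_and]
  split_ifs with h
  · rfl
  · exact hinv p (by omega)

/-- Mark the positions in the registers `20, …, 19 + A` in array `4`. -/
def topP : ℕ → Program
  | 0 => .skip
  | A + 1 => .seq (topP A) (.store 4 (.reg (20 + A)) (.const 1))

@[simp] theorem writesReg_topP (A x : ℕ) : ¬ (topP A).WritesReg x := by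
  induction A with
  | zero => simp [topP, Program.WritesReg]
  | succ A ih => simp [topP, Program.WritesReg, ih]

theorem writesArr_topP (A a : ℕ) (h : (topP A).WritesArr a) : a = 4 := by
  induction A with
  | zero => simp [topP, Program.WritesArr] at h
  | succ A ih =>
    rcases h with h | h
    · exact ih h
    · exact h

theorem runs_topP {σ : State} (A : ℕ) :
    Runs O c (topP A) σ (3 * A + 1) fun σ' =>
      ∀ p, σ'.arr 4 p ≠ 0 ↔ σ.arr 4 p ≠ 0 ∨ ∃ j < A, σ.reg (20 + j) = p := by
  induction A with
  | zero => exact (Runs.skip (by simp)).mono (by simp) fun _ h => h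
  | succ A ih =>
    refine (Runs.seq ih.frame fun σ₁ h1 => Runs.store ?_).mono ?_ fun _ h => h
    · obtain ⟨h1, hag⟩ := h1
      have hr := hag.reg (20 + A) (by simp)
      intro p
      simp only [arr_setCell, Expr.eval, hr, true_and, Nat.lt_succ_iff_lt_or_eq, or_and_right,
        exists_or, exists_eq_left]
      split_ifs with h
      · simp [h]
      · rw [h1 p]
        have : ¬ σ.reg (20 + A) = p := fun h' => h h'.symm
        simp only [this, or_false]
    · simp [Expr.steps]; linarith

/-- The position of element `b` of the block whose number is in register `14`. -/
def posE (B b : ℕ) : Expr := .add (.add (.reg 13) ((Expr.reg 14).mul B)) (.const b)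

theorem eval_posE (σ : State) (B b : ℕ) :
    (posE B b).eval σ = σ.reg 13 + σ.reg 14 * B + b := by
  simp [posE, Expr.eval, mul_comm]

/-- Mark the elements below `b` of the set `X d` in a block, where `d < D` is in register `10`. -/
def writeP (B D : ℕ) (X : ℕ → Finset ℕ) : ℕ → Program
  | 0 => .skip
  | b + 1 => .seq (writeP B D X b) (.store 4 (posE B b) (.add (.arr 4 (posE B b))
      ((Expr.reg 10).lookup (fun d => if b ∈ X d then 1 else 0) D)))

@[simp] theorem writesReg_writeP (B D : ℕ) (X : ℕ → Finset ℕ) (b x : ℕ) :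
    ¬ (writeP B D X b).WritesReg x := by
  induction b with
  | zero => simp [writeP, Program.WritesReg]
  | succ b ih => simp [writeP, Program.WritesReg, ih]

theorem writesArr_writeP (B D : ℕ) (X : ℕ → Finset ℕ) (b a : ℕ)
    (h : (writeP B D X b).WritesArr a) : a = 4 := by
  induction b with
  | zero => simp [writeP, Program.WritesArr] at h
  | succ b ih =>
    rcases h with h | h
    · exact ih h
    · exact h

/-- The indicator is added to the cell rather than stored in it, so marks already present survive.
-/
theorem exists_runs_writeP (B D : ℕ) (X : ℕ → Finset ℕ) (b : ℕ) : ∃ K : ℝ, 0 ≤ K ∧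
    ∀ (n : ℕ) (O : Finset (Fin n) → ℕ → Finset (Fin n)) (c : ℝ) (σ : State), σ.reg 10 < D →
      Runs O c (writeP B D X b) σ K fun σ' => ∀ p, σ'.arr 4 p ≠ 0 ↔ σ.arr 4 p ≠ 0 ∨
        ∃ b' < b, b' ∈ X (σ.reg 10) ∧ σ.reg 13 + σ.reg 14 * B + b' = p := by
  induction b with
  | zero => exact ⟨1, by norm_num, fun n O c σ _ => Runs.skip (by simp)⟩
  | succ b ih =>
    obtain ⟨K, hK, ih⟩ := ih
    refine ⟨K + _, ?_, fun n O c σ hD => Runs.seq (ih n O c σ hD).frame fun σ₁ h1 =>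
      Runs.store ?_⟩
    · positivity
    obtain ⟨h1, hag⟩ := h1
    have r10 := hag.reg 10 (by simp)
    have r13 := hag.reg 13 (by simp)
    have r14 := hag.reg 14 (by simp)
    intro p
    simp only [arr_setCell, Expr.eval, Expr.eval_lookup, eval_posE, r10, r13, r14, true_and, hD,
      if_true, Nat.lt_succ_iff_lt_or_eq, or_and_right, exists_or, exists_eq_left]
    by_cases h : p = σ.reg 13 + σ.reg 14 * B + b
    · rw [if_pos h, ← h]
      have h1p := h1 p
      by_cases hb : b ∈ X (σ.reg 10)
      · simp [hb]
      · simp only [hb, if_false, add_zero, h1p, false_and, or_false]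
    · rw [if_neg h, h1 p]
      have : ¬ σ.reg 13 + σ.reg 14 * B + b = p := fun h' => h h'.symm
      simp only [this, and_false, or_false]

/-- Divide register `9` by cell `reg 14` of array `3`; the quotient is stored in register `10`,
and the remainder in register `9`. -/
def digitP : Program :=
  .seq (.assign 10 (.const 0)) (.loop (.sub (.add (.reg 9) (.const 1)) (.arr 3 (.reg 14)))
    (.seq (.assign 9 (.sub (.reg 9) (.arr 3 (.reg 14))))
      (.assign 10 (.add (.reg 10) (.const 1)))))

/-- Division by repeated subtraction takes constant time here, since `v < p * D` bounds the quotient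
by the constant `D`. -/
theorem runs_digitP {σ : State} {v p D : ℕ} (h9 : σ.reg 9 = v) (hp : σ.arr 3 (σ.reg 14) = p)
    (hp0 : 0 < p) (hD : v < p * D) :
    Runs O c digitP σ (20 * (D + 1)) fun σ' => σ'.reg 10 = v / p ∧ σ'.reg 9 = v % p := by
  have hdm := Nat.div_add_mod v p
  have hml := Nat.mod_lt v hp0
  refine (Runs.seq (Runs.assign (Q := fun σ' => σ' = σ.setReg 10 0) (by simp [Expr.eval]))
    fun σ₁ h1 => Runs.loop (m := v / p)
      (fun k σ' => σ'.reg 10 = k ∧ σ'.reg 9 = v - p * k ∧ σ'.reg 14 = σ.reg 14 ∧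
        σ'.arr 3 = σ.arr 3) (fun _ => 9) ?_ ?_ ?_).mono ?_ fun σ' h => ⟨h.1, ?_⟩
  · subst h1
    simp [h9]
  · rintro k hk σ₂ ⟨a1, a2, a3, a4⟩
    have hle : p * (k + 1) ≤ p * (v / p) := Nat.mul_le_mul_left p hk
    rw [mul_add, mul_one] at hle
    refine ⟨by simp [Expr.eval, a2, a3, a4, hp]; omega, ?_⟩
    refine (Runs.seq (Runs.assign (Q := fun σ' => σ' = σ₂.setReg 9 (v - p * k - p))
      (by simp [Expr.eval, a2, a3, a4, hp])) fun σ₃ h3 => Runs.assign ?_).mono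
      (by simp [Expr.steps]; norm_num) fun _ h => h
    subst h3
    simp [Expr.eval, a1, a3, a4, mul_add]
    omega
  · rintro σ₂ ⟨a1, a2, a3, a4⟩
    simp [Expr.eval, a2, a3, a4, hp]
    omega
  · have : (((v / p : ℕ) : ℝ)) ≤ D := by
      exact_mod_cast ((Nat.div_lt_iff_lt_mul hp0).2 (by rwa [mul_comm])).le
    simp [Expr.steps]
    linarith
  · rw [h.2.1]; omega

/-- Mark the positions of all blocks, and compute the query size in register `12`; the digits of
the counter in register `8` select the entries of `L`. -/
def blocksP (B : ℕ) (L : List (Finset ℕ × ℕ)) : Program :=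
  .seq (.assign 12 (.const 0)) (.seq (.assign 9 (.reg 8)) (.seq (.assign 14 (.reg 5))
    (.loop (.reg 14) (.seq (.assign 14 (.sub (.reg 14) (.const 1))) (.seq digitP
      (.seq (writeP B L.length (fun d => (L.getD d (∅, 0)).1) B)
        (.assign 12 (.add (.reg 12)
          ((Expr.reg 10).lookup (fun d => (L.getD d (∅, 0)).2) L.length)))))))))

/-- Digits are extracted from the leading one downwards: with `V % D ^ (j + 1)` in register `9`,
division by `D ^ j` yields digit `j` and leaves `V % D ^ j`. Hence the invariant speaks of the
blocks from `N - k` on. -/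
theorem exists_runs_blocksP (B : ℕ) (L : List (Finset ℕ × ℕ)) (hL : 0 < L.length) :
    ∃ K : ℝ, 0 ≤ K ∧
    ∀ (n : ℕ) (O : Finset (Fin n) → ℕ → Finset (Fin n)) (c : ℝ) (σ : State) (N V s : ℕ),
      σ.reg 5 = N → σ.reg 8 = V → V < L.length ^ N → σ.reg 13 = s →
      (∀ j ≤ N, σ.arr 3 j = L.length ^ j) →
      Runs O c (blocksP B L) σ (K * (N + 1)) fun σ' => σ'.reg 12 = querySize L N V ∧
        ∀ p, σ'.arr 4 p ≠ 0 ↔ σ.arr 4 p ≠ 0 ∨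
          ∃ j < N, ∃ b < B, b ∈ blockSet L V j ∧ s + j * B + b = p := by
  set D := L.length with hDdef
  obtain ⟨K, hK, hwrite⟩ := exists_runs_writeP B D (fun d => (L.getD d (∅, 0)).1) B
  set E := (Expr.reg 10).lookup (fun d => (L.getD d (∅, 0)).2) D with hE
  have hEs : (0 : ℝ) ≤ E.steps := by positivity
  refine ⟨20 * (D + 1) + K + E.steps + 20, by positivity, fun n O c σ N V s h5 h8 hV h13 h3 => ?_⟩
  refine (Runs.seq (Runs.assign (Q := fun σ' => σ' = σ.setReg 12 0) (by simp [Expr.eval]))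
    fun σ₁ e1 => Runs.seq (Runs.assign (Q := fun σ' => σ' = σ₁.setReg 9 V)
      (by subst e1; simp [Expr.eval, h8])) fun σ₂ e2 => Runs.seq
      (Runs.assign (Q := fun σ' => σ' = σ₂.setReg 14 N)
      (by subst e2 e1; simp [Expr.eval, h5])) fun σ₃ e3 => Runs.loop (m := N)
      (fun k σ' => σ'.reg 14 = N - k ∧ σ'.reg 9 = V % D ^ (N - k) ∧
        σ'.reg 12 = ∑ j ∈ Ico (N - k) N, blockSize L V j ∧
        (∀ p, σ'.arr 4 p ≠ 0 ↔ σ.arr 4 p ≠ 0 ∨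
          ∃ j < N, N - k ≤ j ∧ ∃ b < B, b ∈ blockSet L V j ∧ s + j * B + b = p) ∧
        σ'.reg 13 = s ∧ σ'.arr 3 = σ.arr 3)
      (fun _ => 20 * (D + 1) + K + E.steps + 7) ?_ ?_ ?_).mono ?_ fun σ' h => ⟨?_, fun p => ?_⟩
  · subst e3 e2 e1
    refine ⟨by simp, by simp [Nat.mod_eq_of_lt hV], by simp, fun p => ?_, by simp [h13], rfl⟩
    have : ¬ ∃ j < N, N - 0 ≤ j ∧ ∃ b < B, b ∈ blockSet L V j ∧ s + j * B + b = p := by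
      rintro ⟨j, hj, hj', -⟩; omega
    simp only [this, or_false]
    rfl
  · rintro k hk σ₄ ⟨a14, a9, a12, a4, a13, a3⟩
    refine ⟨by simp [Expr.eval, a14]; omega, ?_⟩
    set j := N - (k + 1) with hj
    have hjk : N - k = j + 1 := by omega
    rw [hjk] at a14 a9 a12
    have hjN : j < N := by omega
    have hDj : 0 < D ^ j := Nat.pow_pos hL
    have hdig : V % D ^ (j + 1) / D ^ j = V / D ^ j % D := by
      rw [pow_succ, Nat.mod_mul_right_div_self]
    have hmod : V % D ^ (j + 1) % D ^ j = V % D ^ j :=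
      Nat.mod_mod_of_dvd _ (pow_dvd_pow _ (by omega))
    refine (Runs.seq (Runs.assign (Q := fun σ' => σ' = σ₄.setReg 14 j)
      (by simp [Expr.eval, a14])) fun σ₅ e5 => Runs.seq (runs_digitP (v := V % D ^ (j + 1))
        (p := D ^ j) (D := D) ?_ ?_ hDj ?_).frame fun σ₆ h6 => Runs.seq
        (hwrite n O c σ₆ ?_).frame fun σ₇ h7 => Runs.assign ?_).mono ?_ fun _ h => h
    · subst e5; simp [a9]
    · subst e5; simp [a3, h3 j (by omega)]
    · rw [← pow_succ]; exact Nat.mod_lt _ (Nat.pow_pos hL)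
    · rw [h6.1.1, hdig]; exact Nat.mod_lt _ hL
    · subst e5
      obtain ⟨⟨h10, h9⟩, hag6⟩ := h6
      obtain ⟨h4, hag7⟩ := h7
      rw [hdig] at h10
      rw [hmod] at h9
      have r12 : σ₇.reg 12 = σ₄.reg 12 := by
        rw [hag7.reg 12 (by simp), hag6.reg 12 (by simp [digitP, Program.WritesReg])]; simp
      have r6_13 : σ₆.reg 13 = s := by
        rw [hag6.reg 13 (by simp [digitP, Program.WritesReg])]; simp [a13]
      have r6_14 : σ₆.reg 14 = j := by
        rw [hag6.reg 14 (by simp [digitP, Program.WritesReg])]; simp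
      have r10 : σ₇.reg 10 = V / D ^ j % D := by rw [hag7.reg 10 (by simp), h10]
      have arr4 : σ₆.arr 4 = σ₄.arr 4 := hag6.arr 4 (by simp [digitP, Program.WritesArr])
      have hlt : V / D ^ j % D < D := Nat.mod_lt _ hL
      refine ⟨?_, ?_, ?_, fun p => ?_, ?_, ?_⟩
      · simp [hag7.reg 14 (by simp), r6_14]
      · simp [hag7.reg 9 (by simp), h9]
      · simp only [reg_setReg, if_true, Expr.eval, Expr.eval_lookup, r12, r10, a12]
        rw [if_pos hlt, Finset.sum_eq_sum_Ico_succ_bot hjN, add_comm]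
        rfl
      · simp only [arr_setReg]
        rw [h4 p, arr4, a4 p, h10, r6_13, r6_14, or_assoc]
        refine or_congr_right ⟨?_, ?_⟩
        · rintro (⟨i, hi, hi', h⟩ | h)
          · exact ⟨i, hi, by omega, h⟩
          · exact ⟨j, hjN, le_rfl, h⟩
        · rintro ⟨i, hi, hi', h⟩
          by_cases hij : i = j
          · subst hij; exact Or.inr h
          · exact Or.inl ⟨i, hi, by omega, h⟩
      · simp [hag7.reg 13 (by simp), r6_13]
      · have x1 := hag7.arr 3 (fun h => by have := writesArr_writeP _ _ _ _ _ h; omega)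
        have x2 := hag6.arr 3 (by simp [digitP, Program.WritesArr])
        simp only [arr_setReg] at x2 ⊢
        rw [x1, x2, a3]
    · simp only [Expr.steps, ← hDdef, ← hE]; push_cast; linarith
  · rintro σ₄ ⟨a14, -⟩
    simp [Expr.eval, a14]
  · simp [Expr.steps]
    have : (0 : ℝ) ≤ N := by positivity
    nlinarith
  · rw [h.2.2.1, Nat.sub_self, Nat.Ico_zero_eq_range, querySize]
  · rw [h.2.2.2.1 p, Nat.sub_self]
    simp

end WSM

namespace WSM

open Finset

variable {n : ℕ} {O : Finset (Fin n) → ℕ → Finset (Fin n)} {c : ℝ}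

/-! ### Querying the oracle and updating the best solution -/

theorem mem_getSet {σ : State} {a : ℕ} {i : Fin n} : i ∈ σ.getSet n a ↔ σ.arr a i ≠ 0 := by
  simp [State.getSet]

theorem getSet_setSet (σ : State) (a : ℕ) (X : Finset (Fin n)) :
    (σ.setSet a X).getSet n a = X := by
  ext i
  rw [mem_getSet]
  simp [State.setSet]

theorem getSet_congr {σ σ' : State} {a a' : ℕ} (h : ∀ i < n, σ'.arr a' i = σ.arr a i) :
    σ'.getSet n a' = σ.getSet n a := by
  ext i
  rw [mem_getSet, mem_getSet, h i i.2]

theorem weight_getSet (w : Fin n → ℕ) {u : ℕ → ℕ} (hu : ∀ i : Fin n, u i = w i) (σ : State)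
    (a : ℕ) : weight w (σ.getSet n a) = ∑ i ∈ range n, if σ.arr a i ≠ 0 then u i else 0 := by
  rw [← Fin.sum_univ_eq_sum_range (fun i => if σ.arr a i ≠ 0 then u i else 0), weight,
    State.getSet, sum_filter]
  exact sum_congr rfl fun i _ => by rw [hu]

/-- Store the elements whose ranks are marked in array `4` in array `5`. -/
def selectP : Program := forP 1 (.reg 0) (.store 5 (.reg 1) (.arr 4 (.arr 2 (.reg 1))))

theorem runs_selectP {σ : State} {m : ℕ} (h0 : σ.reg 0 = m) :
    Runs O c selectP σ (13 * (m + 1)) fun σ' => ∀ i < m, σ'.arr 5 i = σ.arr 4 (σ.arr 2 i) := by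
  refine (Runs.forP_const (fun k σ' => ∀ i < k, σ'.arr 5 i = σ.arr 4 (σ.arr 2 i)) (T := 5)
    (fun k σ v h => h) (by simp) (by simp [Program.WritesReg]) (by simp [Program.WritesReg]) h0
    (by positivity) ?_).mono (by nlinarith) fun _ h => h
  intro k hk σ₁ hag h1 hinv
  refine (Runs.store ?_).mono (by simp [Expr.steps]; norm_num) fun _ h => h
  have e2 := hag.arr 2 (by simp [Program.WritesArr])
  have e4 := hag.arr 4 (by simp [Program.WritesArr])
  intro i hi
  simp only [arr_setCell, Expr.eval, h1, e2, e4, true_and]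
  split_ifs with h
  · rw [h]
  · exact hinv i (by omega)

/-- Add the set in array `5` to the set in array `6`, and add the weight of the result to
register `3`. -/
def uniteP : Program :=
  forP 1 (.reg 0) (.seq (.store 6 (.reg 1) (.add (.arr 6 (.reg 1)) (.arr 5 (.reg 1))))
    (.ite (.arr 6 (.reg 1)) (.assign 3 (.add (.reg 3) (.arr 0 (.reg 1)))) .skip))

theorem runs_uniteP {σ : State} {m : ℕ} (h0 : σ.reg 0 = m) (h3 : σ.reg 3 = 0) :
    Runs O c uniteP σ (23 * (m + 1)) fun σ' =>
      (∀ i < m, σ'.arr 6 i = σ.arr 6 i + σ.arr 5 i) ∧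
      σ'.reg 3 = ∑ i ∈ range m, if σ'.arr 6 i ≠ 0 then σ.arr 0 i else 0 := by
  -- Array `6` is overwritten in place, so the invariant also records that its cells from `k` on are
  -- still original.
  refine (Runs.forP_const (fun k σ' => (∀ i, σ'.arr 6 i =
      if i < k then σ.arr 6 i + σ.arr 5 i else σ.arr 6 i) ∧
      σ'.reg 3 = ∑ i ∈ range k, if σ.arr 6 i + σ.arr 5 i ≠ 0 then σ.arr 0 i else 0) (T := 15)
    (fun k σ v h => by simpa using h) (by simpa using h3) (by simp [Program.WritesReg])
    (by simp [Program.WritesReg]) h0 (by positivity) ?_).mono (by nlinarith) ?_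
  · intro k hk σ₁ hag h1 hinv
    have e0 := hag.arr 0 (by simp [Program.WritesArr])
    have e5 := hag.arr 5 (by simp [Program.WritesArr])
    have e6 : σ₁.arr 6 k = σ.arr 6 k := by rw [hinv.1]; simp
    have hcell : ∀ i, (σ₁.setCell 6 k (σ.arr 6 k + σ.arr 5 k)).arr 6 i =
        if i < k + 1 then σ.arr 6 i + σ.arr 5 i else σ.arr 6 i := by
      intro i
      simp only [arr_setCell, true_and]
      split_ifs with h h' h'
      · rw [h]
      · omega
      · rw [hinv.1, if_pos (by omega)]
      · rw [hinv.1, if_neg (by omega)]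
    refine (Runs.seq (Runs.store
      (Q := fun σ' => σ' = σ₁.setCell 6 k (σ.arr 6 k + σ.arr 5 k))
      (by simp [Expr.eval, h1, e5, e6])) fun σ₂ h2 => Runs.ite (T := 5)
      (fun h => (Runs.assign ?_).mono (by simp [Expr.steps]; norm_num) fun _ h => h)
      fun h => (Runs.skip ?_).mono (by norm_num) fun _ h => h).mono
      (by simp [Expr.steps]; norm_num) fun _ h => h
    · subst h2
      refine ⟨hcell, ?_⟩
      simp only [Expr.eval, arr_setCell, reg_setCell, h1, and_self, if_true] at h
      simp [Expr.eval, h1, e0, hinv.2, sum_range_succ]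
      omega
    · subst h2
      refine ⟨hcell, ?_⟩
      simp only [Expr.eval, arr_setCell, reg_setCell, h1, and_self, if_true] at h
      rw [sum_range_succ, if_neg (not_not.2 h)]
      exact hinv.2
  · rintro σ' ⟨h6, h3⟩
    have : ∀ i < m, σ'.arr 6 i = σ.arr 6 i + σ.arr 5 i := fun i hi => by rw [h6, if_pos hi]
    refine ⟨this, h3.trans (sum_congr rfl fun i hi => ?_)⟩
    rw [this i (mem_range.1 hi)]

/-- Replace the best solution by the set in array `6` if its weight, in register `3`, is smaller. -/
def updateP : Program :=
  .ite (.sub (.reg 4) (.reg 3))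
    (.seq (.assign 4 (.reg 3)) (forP 1 (.reg 0) (.store 1 (.reg 1) (.arr 6 (.reg 1))))) .skip

theorem runs_updateP {σ : State} {m : ℕ} (h0 : σ.reg 0 = m) :
    Runs O c updateP σ (20 * (m + 1)) fun σ' => σ'.reg 4 = min (σ.reg 4) (σ.reg 3) ∧
      ((σ'.reg 4 = σ.reg 4 ∧ σ'.arr 1 = σ.arr 1) ∨
        (σ'.reg 4 = σ.reg 3 ∧ ∀ i < m, σ'.arr 1 i = σ.arr 6 i)) := by
  refine (Runs.ite (T := 12 * (m + 1) + 2) (fun h => ?_) fun h => ?_).mono ?_ fun _ h => h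
  · simp only [Expr.eval] at h
    refine (Runs.seq (Runs.assign (Q := fun σ' => σ' = σ.setReg 4 (σ.reg 3))
      (by simp [Expr.eval])) fun σ₁ h1 => Runs.forP_const (T := 4) (M := m)
      (fun k σ' => σ'.reg 4 = σ.reg 3 ∧ ∀ i < k, σ'.arr 1 i = σ.arr 6 i)
      (fun k σ v h => by simpa using h) ?_ (by simp [Program.WritesReg])
      (by simp [Program.WritesReg]) ?_ (by positivity) ?_).mono ?_ fun σ' h' => ?_
    · subst h1; simp
    · subst h1; simp [h0]
    · subst h1
      intro k hk σ₂ hag hr hinv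
      have e6 := hag.arr 6 (by simp [Program.WritesArr])
      refine (Runs.store ?_).mono (by simp [Expr.steps]; norm_num) fun _ h => h
      refine ⟨hinv.1, fun i hi => ?_⟩
      simp only [arr_setCell, Expr.eval, hr, e6, true_and, arr_setReg]
      split_ifs with h
      · rw [h]
      · exact hinv.2 i (by omega)
    · simp [Expr.steps]; linarith
    · exact ⟨by rw [h'.1]; omega, Or.inr h'⟩
  · simp only [Expr.eval] at h
    exact (Runs.skip ⟨by omega, Or.inl ⟨rfl, rfl⟩⟩).mono (by nlinarith) fun _ h => h
  · simp [Expr.steps]; nlinarith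

/-! ### The treatment of a guess -/

/-- The data which are available in the memory when the guesses are treated. -/
structure Ready (w : Fin n → ℕ) (F : Set (Finset (Fin n))) (u : ℕ → ℕ) (N D : ℕ) (σ : State) :
    Prop where
  reg0 : σ.reg 0 = n
  reg5 : σ.reg 5 = N
  arr0 : σ.arr 0 = u
  arr2 : ∀ i < n, σ.arr 2 i = rank u n i
  arr3 : ∀ j ≤ N, σ.arr 3 j = D ^ j
  mem : σ.getSet n 1 ∈ F
  best : σ.reg 4 = weight w (σ.getSet n 1)

/-- Treat the guess in the registers `8`, `13` and `20, …, 19 + B`. -/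
def guessP (B : ℕ) (L : List (Finset ℕ × ℕ)) : Program :=
  .seq clearP (.seq (topP B) (.seq (blocksP B L) (.seq selectP (.seq (.query 5 (.reg 12) 6)
    (.seq (.assign 3 (.const 0)) (.seq uniteP updateP))))))

theorem writesReg_guessP {B : ℕ} {L : List (Finset ℕ × ℕ)} {x : ℕ}
    (h : (guessP B L).WritesReg x) :
    x = 1 ∨ x = 3 ∨ x = 4 ∨ x = 9 ∨ x = 10 ∨ x = 12 ∨ x = 14 := by
  simp only [guessP, clearP, blocksP, digitP, selectP, uniteP, updateP, Program.WritesReg,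
    writesReg_forP, writesReg_topP, writesReg_writeP] at h
  tauto

/-- Every guess, good or bad, yields a member of `F` by the first oracle property alone, so the
stored solution stays feasible and never gets worse. The weight guarantee of the oracle is needed
only for one good guess. -/
theorem exists_runs_guessP (B : ℕ) (L : List (Finset ℕ × ℕ)) (hL : 0 < L.length) :
    ∃ K : ℝ, 0 ≤ K ∧ ∀ (n : ℕ) (O : Finset (Fin n) → ℕ → Finset (Fin n)) (c : ℝ) (w : Fin n → ℕ)
      (F : Set (Finset (Fin n))) (u : ℕ → ℕ) (N : ℕ) (σ : State), (∀ i : Fin n, u i = w i) →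
      (∀ S ℓ, O S ℓ ∪ S ∈ F) → N ≤ n → Ready w F u N L.length σ → σ.reg 8 < L.length ^ N →
      Runs O c (guessP B L) σ (K * (n + 1) + c ^ querySize L N (σ.reg 8)) fun σ' =>
        Ready w F u N L.length σ' ∧ σ'.reg 4 ≤ σ.reg 4 ∧
        ∀ S : Finset (Fin n), S = chosenSet (rank u n) L B N (fun j => σ.reg (20 + j)) (σ.reg 13)
          (σ.reg 8) → σ'.reg 4 ≤ weight w (O S (querySize L N (σ.reg 8)) ∪ S) := by
  obtain ⟨K, hK, hblocks⟩ := exists_runs_blocksP B L hL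
  refine ⟨K + 3 * B + 100, by positivity, fun n O c w F u N σ hu hOF hNn hσ hV => ?_⟩
  set S : Finset (Fin n) :=
    chosenSet (rank u n) L B N (fun j => σ.reg (20 + j)) (σ.reg 13) (σ.reg 8) with hS
  refine (Runs.seq (runs_clearP hσ.reg0).frame fun σ₁ h1 => Runs.seq (runs_topP B).frame
    fun σ₂ h2 => Runs.seq (R := fun σ' => Ready w F u N L.length σ' ∧ σ'.reg 4 = σ.reg 4 ∧
      σ'.reg 12 = querySize L N (σ.reg 8) ∧ ∀ i : Fin n, σ'.arr 4 (rank u n i) ≠ 0 ↔ i ∈ S)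
      ((hblocks n O c σ₂ N (σ.reg 8) (σ.reg 13) ?_ ?_ hV ?_ ?_).frame.mono le_rfl ?_)
    fun σ₃ h3 => Runs.seq (runs_selectP h3.1.reg0).frame fun σ₄ h4 => Runs.seq
      (T := 2 + c ^ querySize L N (σ.reg 8))
      (R := fun σ' => Ready w F u N L.length σ' ∧ σ'.reg 4 = σ.reg 4 ∧ σ'.getSet n 5 = S ∧
        σ'.getSet n 6 = O S (querySize L N (σ.reg 8)))
      ((Runs.query ?_).mono ?_ fun _ h => h) fun σ₅ h5 => Runs.seq
      (Runs.assign (Q := fun σ' => σ' = σ₅.setReg 3 0) (by simp [Expr.eval])) fun σ₆ h6 =>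
      Runs.seq (runs_uniteP (m := n) ?_ ?_).frame
        fun σ₇ h7 => (runs_updateP (m := n) ?_).frame.mono le_rfl ?_).mono ?_ fun _ h => h
  · rw [h2.2.reg 5 (by simp), h1.2.reg 5 (by simp [clearP, Program.WritesReg]), hσ.reg5]
  · rw [h2.2.reg 8 (by simp), h1.2.reg 8 (by simp [clearP, Program.WritesReg])]
  · rw [h2.2.reg 13 (by simp), h1.2.reg 13 (by simp [clearP, Program.WritesReg])]
  · intro j hj
    rw [h2.2.arr 3 (fun h => by have := writesArr_topP _ _ h; omega),
      h1.2.arr 3 (by simp [clearP, Program.WritesArr]), hσ.arr3 j hj]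
  · rintro σ₃ ⟨⟨h12, h4⟩, hag3⟩
    have r : ∀ x, x ≠ 1 → x ≠ 9 → x ≠ 10 → x ≠ 12 → x ≠ 14 → σ₃.reg x = σ.reg x := by
      intro x x1 x9 x10 x12 x14
      rw [hag3.reg x (by simp [blocksP, digitP, Program.WritesReg, *]), h2.2.reg x (by simp),
        h1.2.reg x (by simp [clearP, Program.WritesReg, *])]
    have a : ∀ x, x ≠ 4 → σ₃.arr x = σ.arr x := by
      intro x x4
      rw [hag3.arr x ?_, h2.2.arr x (fun h => x4 (writesArr_topP _ _ h)),
        h1.2.arr x (by simp [clearP, Program.WritesArr, *])]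
      simp only [blocksP, digitP, Program.WritesArr, false_or, or_false]
      exact fun h => x4 (writesArr_writeP _ _ _ _ _ h)
    have hget : σ₃.getSet n 1 = σ.getSet n 1 := getSet_congr fun i _ => by rw [a 1 (by norm_num)]
    refine ⟨⟨?_, ?_, ?_, ?_, ?_, ?_, ?_⟩, ?_, h12, fun i => ?_⟩
    · rw [r 0 (by norm_num) (by norm_num) (by norm_num) (by norm_num) (by norm_num), hσ.reg0]
    · rw [r 5 (by norm_num) (by norm_num) (by norm_num) (by norm_num) (by norm_num), hσ.reg5]
    · rw [a 0 (by norm_num), hσ.arr0]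
    · rw [a 2 (by norm_num)]; exact hσ.arr2
    · rw [a 3 (by norm_num)]; exact hσ.arr3
    · rw [hget]; exact hσ.mem
    · rw [r 4 (by norm_num) (by norm_num) (by norm_num) (by norm_num) (by norm_num), hget, hσ.best]
    · rw [r 4 (by norm_num) (by norm_num) (by norm_num) (by norm_num) (by norm_num)]
    · rw [h4, h2.1, h1.1 _ (rank_lt u i.2), hS, mem_chosenSet]
      have : ∀ j, σ₁.reg (20 + j) = σ.reg (20 + j) := fun j =>
        h1.2.reg (20 + j) (by simp [clearP, Program.WritesReg]; omega)
      simp only [this, ne_eq, not_true, false_or]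
      rfl
  · obtain ⟨h3, h34, h312, h3S⟩ := h3
    obtain ⟨h45, hag⟩ := h4
    have r : ∀ x, x ≠ 1 → σ₄.reg x = σ₃.reg x := fun x x1 =>
      hag.reg x (by simp [selectP, Program.WritesReg, *])
    have a : ∀ x, x ≠ 5 → σ₄.arr x = σ₃.arr x := fun x x5 =>
      hag.arr x (by simp [selectP, Program.WritesArr, *])
    have hS4 : σ₄.getSet n 5 = S := by
      ext i
      rw [mem_getSet, h45 i i.2, h3.arr2 i i.2, h3S]
    have a' : ∀ x, x ≠ 5 → x ≠ 6 → ∀ X : Finset (Fin n), (σ₄.setSet 6 X).arr x = σ₃.arr x := by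
      intro x x5 x6 X
      simp [State.setSet, x6, a x x5]
    have hget : ∀ X : Finset (Fin n), (σ₄.setSet 6 X).getSet n 1 = σ₃.getSet n 1 := fun X =>
      getSet_congr fun i _ => by rw [a' 1 (by norm_num) (by norm_num)]
    refine ⟨⟨?_, ?_, ?_, ?_, ?_, ?_, ?_⟩, ?_, ?_, ?_⟩
    · exact (r 0 (by norm_num)).trans h3.reg0
    · exact (r 5 (by norm_num)).trans h3.reg5
    · rw [a' 0 (by norm_num) (by norm_num), h3.arr0]
    · rw [a' 2 (by norm_num) (by norm_num)]; exact h3.arr2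
    · rw [a' 3 (by norm_num) (by norm_num)]; exact h3.arr3
    · rw [hget]; exact h3.mem
    · rw [hget]; exact (r 4 (by norm_num)).trans h3.best
    · exact (r 4 (by norm_num)).trans h34
    · rw [← hS4]
      exact getSet_congr fun i _ => by simp [State.setSet]
    · rw [getSet_setSet, hS4, Expr.eval, r 12 (by norm_num), h312]
  · simp only [Expr.eval, Expr.steps, h4.2.reg 12 (by simp [selectP, Program.WritesReg]),
      h3.2.2.1]
    push_cast; linarith
  · subst h6; simp [h5.1.reg0]
  · subst h6; simp
  · subst h6
    rw [h7.2.reg 0 (by simp [uniteP, Program.WritesReg])]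
    simp [h5.1.reg0]
  · subst h6
    rintro σ₈ ⟨⟨hmin, hcase⟩, hag8⟩
    obtain ⟨h5, h54, h5S, h5X⟩ := h5
    obtain ⟨⟨h76, h73⟩, hag7⟩ := h7
    simp only [arr_setReg] at h76 h73
    have hget6 : σ₇.getSet n 6 = O S (querySize L N (σ.reg 8)) ∪ S := by
      ext i
      rw [mem_getSet, h76 i i.2, mem_union, ← h5X, ← h5S, mem_getSet, mem_getSet]
      omega
    have hw7 : σ₇.reg 3 = weight w (O S (querySize L N (σ.reg 8)) ∪ S) := by
      rw [h73, h5.arr0, ← weight_getSet w hu, hget6]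
    have r7 : ∀ x, x ≠ 1 → x ≠ 3 → σ₇.reg x = σ₅.reg x := fun x x1 x3 => by
      rw [hag7.reg x (by simp [uniteP, Program.WritesReg, *])]; simp [x3]
    have a7 : ∀ x, x ≠ 6 → σ₇.arr x = σ₅.arr x := fun x x6 =>
      hag7.arr x (by simp [uniteP, Program.WritesArr, *])
    have r8 : ∀ x, x ≠ 1 → x ≠ 4 → σ₈.reg x = σ₇.reg x := fun x x1 x4 =>
      hag8.reg x (by simp [updateP, Program.WritesReg, *])
    have a8 : ∀ x, x ≠ 1 → σ₈.arr x = σ₇.arr x := fun x x1 =>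
      hag8.arr x (by simp [updateP, Program.WritesArr, *])
    have hbest : σ₈.getSet n 1 ∈ F ∧ σ₈.reg 4 = weight w (σ₈.getSet n 1) := by
      rcases hcase with ⟨e1, e2⟩ | ⟨e1, e2⟩
      · have hg : σ₈.getSet n 1 = σ₅.getSet n 1 := getSet_congr fun i _ => by
          rw [e2, a7 1 (by norm_num)]
        rw [hg, e1, r7 4 (by norm_num) (by norm_num)]
        exact ⟨h5.mem, h5.best⟩
      · have hg : σ₈.getSet n 1 = O S (querySize L N (σ.reg 8)) ∪ S := by
          rw [← hget6]; exact getSet_congr e2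
        rw [hg, e1, hw7]
        exact ⟨hOF _ _, rfl⟩
    refine ⟨⟨?_, ?_, ?_, ?_, ?_, hbest.1, hbest.2⟩, ?_, ?_⟩
    · rw [r8 0 (by norm_num) (by norm_num), r7 0 (by norm_num) (by norm_num), h5.reg0]
    · rw [r8 5 (by norm_num) (by norm_num), r7 5 (by norm_num) (by norm_num), h5.reg5]
    · rw [a8 0 (by norm_num), a7 0 (by norm_num), h5.arr0]
    · rw [a8 2 (by norm_num), a7 2 (by norm_num)]; exact h5.arr2
    · rw [a8 3 (by norm_num), a7 3 (by norm_num)]; exact h5.arr3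
    · rw [hmin, r7 4 (by norm_num) (by norm_num), h54]; exact min_le_left _ _
    · rintro _ rfl
      rw [hmin, hw7]; exact min_le_right _ _
  · have hN : (N : ℝ) ≤ n := by exact_mod_cast hNn
    have hKN := mul_le_mul_of_nonneg_left hN hK
    have hBn : (0 : ℝ) ≤ 3 * B * n := by positivity
    simp only [Expr.steps]
    push_cast
    nlinarith

end WSM

/-! ### Enumeration of all guesses and the final running time. -/

namespace WSM

open Finset

/-! ### The search over all guesses -/

section

variable {n : ℕ} {O : Finset (Fin n) → ℕ → Finset (Fin n)} {c : ℝ}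

/-- A loop reaches `Done` if its body reaches `Done` for the value `v` of the loop register,
provided that the other registers satisfy `Match`. -/
theorem Runs.search {i : ℕ} {m : Expr} {P : Program} (J Done Match : State → Prop) (T : ℕ → ℝ)
    {M v : ℕ} {σ : State} (hJ : ∀ σ x, J σ → J (σ.setReg i x))
    (hD : ∀ σ x, Done σ → Done (σ.setReg i x)) (hMi : ∀ σ x, Match σ → Match (σ.setReg i x))
    (hMP : ∀ σ σ', Agree P σ σ' → Match σ → Match σ') (hP : ¬ P.WritesReg i)
    (hm : ∀ σ', Agree (WSM.forP i m P) σ σ' → m.eval σ' = M) (hv : v < M)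
    (hbody : ∀ σ, J σ → σ.reg i < M → Runs O c P σ (T (σ.reg i)) fun σ' =>
      J σ' ∧ (Done σ → Done σ') ∧ (Match σ → σ.reg i = v → Done σ')) (hσ : J σ) :
    Runs O c (WSM.forP i m P) σ (∑ k ∈ range M, (T k + (m.steps + 7)) + (m.steps + 5)) fun σ' =>
      J σ' ∧ (Done σ → Done σ') ∧ (Match σ → Done σ') := by
  -- `Done` persists once reached, so it suffices that the round with counter `v` reaches it: the
  -- last clause holds as soon as the counter has passed `v`.
  refine (Runs.forP (fun k σ' => J σ' ∧ (Done σ → Done σ') ∧ (Match σ → Match σ') ∧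
    (Match σ → v < k → Done σ')) T ?_ ⟨hσ, id, id, by simp⟩ hP hm ?_).mono le_rfl ?_
  · rintro k σ' x ⟨h1, h2, h3, h4⟩
    exact ⟨hJ _ _ h1, fun h => hD _ _ (h2 h), fun h => hMi _ _ (h3 h), fun h h' => hD _ _ (h4 h h')⟩
  · rintro k hk σ' - rfl ⟨h1, h2, h3, h4⟩
    refine (hbody σ' h1 hk).frame.mono le_rfl ?_
    rintro σ'' ⟨⟨g1, g2, g3⟩, hag⟩
    refine ⟨g1, fun h => g2 (h2 h), fun h => hMP _ _ hag (h3 h), fun h h' => ?_⟩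
    rcases Nat.lt_succ_iff_lt_or_eq.1 h' with h'' | h''
    · exact g2 (h4 h h'')
    · exact g3 (h3 h) h''.symm
  · rintro σ' ⟨h1, h2, -, h4⟩
    exact ⟨h1, h2, fun h => h4 h hv⟩

theorem Ready.setReg {w : Fin n → ℕ} {F : Set (Finset (Fin n))} {u : ℕ → ℕ} {N D : ℕ} {σ : State}
    (h : Ready w F u N D σ) {i : ℕ} (hi : 6 ≤ i) (x : ℕ) : Ready w F u N D (σ.setReg i x) := by
  have h0 : ¬ 0 = i := by omega
  have h4 : ¬ 4 = i := by omega
  have h5 : ¬ 5 = i := by omega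
  exact ⟨by simp [h0, h.reg0], by simp [h5, h.reg5], h.arr0, h.arr2, h.arr3, h.mem,
    by rw [reg_setReg, if_neg h4]; exact h.best⟩

/-- Nested loops over the values `0, …, n` of the registers `20, …, 19 + A`. -/
def nestP (P : Program) : ℕ → Program
  | 0 => P
  | A + 1 => forP (20 + A) (.add (.reg 0) (.const 1)) (nestP P A)

theorem writesReg_nestP {P : Program} {A x : ℕ} (h : (nestP P A).WritesReg x) :
    P.WritesReg x ∨ ∃ j < A, x = 20 + j := by
  induction A with
  | zero => exact Or.inl h
  | succ A ih =>
    simp only [nestP, writesReg_forP] at h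
    rcases h with h | h
    · exact Or.inr ⟨A, by omega, h⟩
    · rcases ih h with h | ⟨j, hj, h⟩
      · exact Or.inl h
      · exact Or.inr ⟨j, by omega, h⟩

/-- The search over all start positions of the blocks and all values of the counter. -/
def innerP (B : ℕ) (L : List (Finset ℕ × ℕ)) : Program :=
  forP 13 (.add (.reg 0) (.const 1)) (forP 8 (.arr 3 (.reg 5)) (guessP B L))

theorem writesReg_innerP {B : ℕ} {L : List (Finset ℕ × ℕ)} {x : ℕ}
    (h : (innerP B L).WritesReg x) : x ≠ 0 ∧ x ≠ 5 ∧ x < 20 := by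
  simp only [innerP, writesReg_forP] at h
  rcases h with h | h | h
  · omega
  · omega
  · have := writesReg_guessP h; omega

theorem not_writesArr_three_guessP (B : ℕ) (L : List (Finset ℕ × ℕ)) :
    ¬ (guessP B L).WritesArr 3 := by
  simp only [guessP, clearP, blocksP, digitP, selectP, uniteP, updateP, Program.WritesArr,
    writesArr_forP]
  have h1 := fun A => mt (writesArr_topP A 3) (by norm_num)
  have h2 := fun B D X b => mt (writesArr_writeP B D X b 3) (by norm_num)
  simp [h1, h2]

/-- The time for a loop over `0, …, n` with a body of time `T`. -/
theorem sum_range_succ_add_le (n : ℕ) {T : ℝ} (hT : 1 ≤ T) :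
    ∑ _k ∈ range (n + 1), (T + (((Expr.add (.reg 0) (.const 1)).steps : ℕ) + 7))
      + (((Expr.add (.reg 0) (.const 1)).steps : ℕ) + 5) ≤ 19 * (n + 1) * T := by
  simp [Expr.steps]
  have : (0 : ℝ) ≤ n := by positivity
  nlinarith [mul_nonneg this (show 0 ≤ T - 1 by linarith)]

end

/-- Bounds the number of counter values, hence the overhead outside the queries, by the query cost.
-/
theorem length_le_sum_pow {c : ℝ} (hc : 1 ≤ c) (L : List (Finset ℕ × ℕ)) :
    (L.length : ℝ) ≤ (L.map fun e => c ^ e.2).sum := by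
  induction L with
  | nil => simp
  | cons e L ih =>
    have := one_le_pow₀ hc (n := e.2)
    simp only [List.length_cons, List.map_cons, List.sum_cons]
    push_cast
    linarith

/-- The search over all guesses finds a solution of weight at most `β * opt`. -/
theorem exists_runs_search {α c β : ℝ} (hα : 1 ≤ α) (hc : 1 ≤ c) (hβ : 1 < β) {B : ℕ}
    {L : List (Finset ℕ × ℕ)} (hL : ∀ K ⊆ range B, ∃ e ∈ L, Covers α β e.1 e.2 K) :
    ∃ K : ℝ, 1 ≤ K ∧ ∀ (n : ℕ) (O : Finset (Fin n) → ℕ → Finset (Fin n)) (w : Fin n → ℕ)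
      (F : Set (Finset (Fin n))) (u : ℕ → ℕ) (N : ℕ) (σ : State), (∀ i : Fin n, u i = w i) →
      IsMonotone F → IsExtensionOracle α w F O → N ≤ n → n ≤ N * B →
      Ready w F u N L.length σ →
      Runs O c (nestP (innerP B L) B) σ
        ((19 * (n + 1)) ^ (B + 1) * (K * (n + 1) * (L.map fun e => c ^ e.2).sum ^ N)) fun σ' =>
          σ'.getSet n 1 ∈ F ∧ (weight w (σ'.getSet n 1) : ℝ) ≤ β * opt w F := by
  have hLpos : 0 < L.length := by
    obtain ⟨e, he, -⟩ := hL ∅ (empty_subset _)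
    exact List.length_pos_of_mem he
  obtain ⟨K, hK, hguess⟩ := exists_runs_guessP B L hLpos
  -- The `17` collects the counter loop: `9` for its control in each round, `1` for the query costs,
  -- `7` for its end.
  refine ⟨K + 17, by linarith, fun n O w F u N σ hu hF hO hNn hnN hσ => ?_⟩
  obtain ⟨q, s, V, hq, hs, hV, hgood⟩ := exists_good_guess hα hβ hL hnN w u hu hF hO
  set D := L.length with hD
  set Λ := (L.map fun e => c ^ e.2).sum with hΛ
  have hDΛ : (D : ℝ) ≤ Λ := length_le_sum_pow hc L
  have hD1 : (1 : ℝ) ≤ D := by exact_mod_cast hLpos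
  have hDN : (D : ℝ) ^ N ≤ Λ ^ N := pow_le_pow_left₀ (by linarith) hDΛ N
  have hΛ1 : 1 ≤ Λ ^ N := one_le_pow₀ (by linarith)
  have hn0 : (0 : ℝ) ≤ n := by positivity
  let Done : State → Prop := fun σ => (σ.reg 4 : ℝ) ≤ β * opt w F
  have hDone : ∀ i, 6 ≤ i → ∀ σ x, Done σ → Done (σ.setReg i x) := by
    intro i hi σ x h
    have h4 : ¬ 4 = i := by omega
    simpa [Done, h4] using h
  have hcounter : ∀ σ, Ready w F u N D σ → Runs O c (forP 8 (.arr 3 (.reg 5)) (guessP B L)) σ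
      ((K + 17) * (n + 1) * Λ ^ N) fun σ' => Ready w F u N D σ' ∧ (Done σ → Done σ') ∧
        ((σ.reg 13 = s ∧ ∀ j < B, σ.reg (20 + j) = q j) → Done σ') := by
    intro σ hσ
    refine (Runs.search (Ready w F u N D) Done
      (fun σ => σ.reg 13 = s ∧ ∀ j < B, σ.reg (20 + j) = q j)
      (fun V => K * (n + 1) + c ^ querySize L N V) (M := D ^ N) (v := V)
      (fun σ x h => h.setReg (by norm_num) x) (hDone 8 (by norm_num)) ?_ ?_
      (fun h => by have := writesReg_guessP h; omega) ?_ hV ?_ hσ).mono ?_ fun _ h => h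
    · intro σ x h
      refine ⟨by simpa using h.1, fun j hj => ?_⟩
      have : ¬ 20 + j = 8 := by omega
      simpa [this] using h.2 j hj
    · intro σ σ' hag h
      refine ⟨?_, fun j hj => ?_⟩
      · rw [hag.reg 13 (fun h => by have := writesReg_guessP h; omega)]; exact h.1
      · rw [hag.reg (20 + j) (fun h => by have := writesReg_guessP h; omega)]; exact h.2 j hj
    · intro σ' hag
      have h5 : σ'.reg 5 = N := by
        rw [hag.reg 5 (by
          rw [writesReg_forP]; rintro (h | h)
          · omega
          · have := writesReg_guessP h; omega), hσ.reg5]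
      have h3 : σ'.arr 3 = σ.arr 3 := hag.arr 3 (by
        rw [writesArr_forP]; exact not_writesArr_three_guessP B L)
      simp only [Expr.eval, h5, h3]
      exact hσ.arr3 N le_rfl
    · intro σ hσ hlt
      refine (hguess n O c w F u N σ hu hO.union_mem hNn hσ hlt).mono le_rfl ?_
      rintro σ' ⟨h1, h2, h3⟩
      refine ⟨h1, fun h => ?_, fun h h8 => ?_⟩
      · have : (σ'.reg 4 : ℝ) ≤ σ.reg 4 := by exact_mod_cast h2
        exact this.trans h
      · have h4 := h3 _ rfl
        have e : (chosenSet (rank u n) L B N (fun j => σ.reg (20 + j)) (σ.reg 13) (σ.reg 8)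
            : Finset (Fin n)) = chosenSet (rank u n) L B N q s V := by
          ext i
          rw [mem_chosenSet, mem_chosenSet, h8, h.1]
          simp only [positions, Set.mem_ofPred_eq]
          refine or_congr_left (exists_congr fun j => and_congr_right fun hj => ?_)
          rw [h.2 j hj]
        rw [e, h8] at h4
        refine le_trans ?_ hgood
        exact_mod_cast h4
    · rw [show (∑ k ∈ range (D ^ N), (K * ((n : ℝ) + 1) + c ^ querySize L N k
          + (((Expr.arr 3 (.reg 5)).steps : ℕ) + 7)))
        = (D : ℝ) ^ N * (K * (n + 1) + 9) + Λ ^ N by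
          have := sum_pow_blockSize L c N
          simp only [← hD, ← hΛ] at this
          rw [← this]
          simp only [sum_add_distrib, sum_const, card_range, nsmul_eq_mul, Expr.steps, querySize]
          push_cast
          ring]
      simp only [Expr.steps]
      push_cast
      have h1 := mul_le_mul_of_nonneg_right hDN (show 0 ≤ K * (n + 1) + 9 by positivity)
      have h2 : 0 ≤ Λ ^ N * n := by positivity
      nlinarith
  have hpos : 1 ≤ (K + 17) * (n + 1) * Λ ^ N := by
    have : 1 ≤ (K + 17) * ((n : ℝ) + 1) := by nlinarith
    nlinarith
  have hinner : ∀ σ, Ready w F u N D σ → Runs O c (innerP B L) σ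
      (19 * (n + 1) * ((K + 17) * (n + 1) * Λ ^ N)) fun σ' => Ready w F u N D σ' ∧
        (Done σ → Done σ') ∧ ((∀ j < B, σ.reg (20 + j) = q j) → Done σ') := by
    intro σ hσ
    refine (Runs.search (Ready w F u N D) Done (fun σ => ∀ j < B, σ.reg (20 + j) = q j)
      (fun _ => (K + 17) * (n + 1) * Λ ^ N) (M := n + 1) (v := s)
      (fun σ x h => h.setReg (by norm_num) x) (hDone 13 (by norm_num)) ?_ ?_ ?_ ?_ (by omega)
      ?_ hσ).mono (sum_range_succ_add_le n hpos) fun _ h => h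
    · intro σ x h j hj
      have : ¬ 20 + j = 13 := by omega
      simpa [this] using h j hj
    · intro σ σ' hag h j hj
      rw [hag.reg (20 + j) (by
        rw [writesReg_forP]; rintro (h | h)
        · omega
        · have := writesReg_guessP h; omega)]
      exact h j hj
    · rw [writesReg_forP]; rintro (h | h)
      · omega
      · have := writesReg_guessP h; omega
    · intro σ' hag
      have h0 := hag.reg 0 (fun h => (writesReg_innerP h).1 rfl)
      simp [Expr.eval, h0, hσ.reg0]
    · intro σ hσ _
      refine (hcounter σ hσ).mono le_rfl ?_
      rintro σ' ⟨h1, h2, h3⟩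
      exact ⟨h1, h2, fun h h' => h3 ⟨h', h⟩⟩
  -- The inner `A` loops find the first `A` guesses themselves; only the registers set by the loops
  -- further out must already agree with `q`.
  have hnest : ∀ A ≤ B, ∀ σ, Ready w F u N D σ → Runs O c (nestP (innerP B L) A) σ
      ((19 * (n + 1)) ^ (A + 1) * ((K + 17) * (n + 1) * Λ ^ N)) fun σ' => Ready w F u N D σ' ∧
        (Done σ → Done σ') ∧ ((∀ j, A ≤ j → j < B → σ.reg (20 + j) = q j) → Done σ') := by
    intro A
    induction A with
    | zero =>
      intro _ σ hσ
      refine (hinner σ hσ).mono (by simp) ?_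
      rintro σ' ⟨h1, h2, h3⟩
      exact ⟨h1, h2, fun h => h3 fun j hj => h j (Nat.zero_le _) hj⟩
    | succ A ih =>
      intro hA σ hσ
      have hwr : ∀ x, (nestP (innerP B L) A).WritesReg x → x ≠ 0 ∧ x < 20 + A := by
        intro x hx
        rcases writesReg_nestP hx with h | ⟨j, hj, h⟩
        · have := writesReg_innerP h; omega
        · omega
      have hTA : 1 ≤ (19 * ((n : ℝ) + 1)) ^ (A + 1) * ((K + 17) * (n + 1) * Λ ^ N) :=
        one_le_mul_of_one_le_of_one_le (one_le_pow₀ (by linarith)) hpos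
      refine (Runs.search (Ready w F u N D) Done
        (fun σ => ∀ j, A + 1 ≤ j → j < B → σ.reg (20 + j) = q j)
        (fun _ => (19 * ((n : ℝ) + 1)) ^ (A + 1) * ((K + 17) * (n + 1) * Λ ^ N)) (M := n + 1)
        (v := q A) (fun σ x h => h.setReg (by omega) x) (hDone _ (by omega)) ?_ ?_ ?_ ?_
        (by have := hq A; omega) ?_ hσ).mono ((sum_range_succ_add_le n hTA).trans ?_) fun _ h => h
      · intro σ x h j hj hj'
        have : ¬ j = A := by omega
        simpa [this] using h j hj hj'
      · intro σ σ' hag h j hj hj'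
        rw [hag.reg (20 + j) (fun h => by have := hwr _ h; omega)]
        exact h j hj hj'
      · intro h; have := hwr _ h; omega
      · intro σ' hag
        have h0 := hag.reg 0 (by
          rw [writesReg_forP]; rintro (h | h)
          · omega
          · exact (hwr _ h).1 rfl)
        simp [Expr.eval, h0, hσ.reg0]
      · intro σ hσ _
        refine (ih (by omega) σ hσ).mono le_rfl ?_
        rintro σ' ⟨h1, h2, h3⟩
        refine ⟨h1, h2, fun h h' => h3 fun j hj hj' => ?_⟩
        by_cases hjA : j = A
        · rw [hjA]; exact h'
        · exact h j (by omega) hj'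
      · apply le_of_eq; ring
  refine (hnest B le_rfl σ hσ).mono le_rfl ?_
  rintro σ' ⟨h1, -, h3⟩
  refine ⟨h1.mem, ?_⟩
  rw [← h1.best]
  exact h3 fun j hj hj' => absurd hj' (by omega)

/-! ### The algorithm -/

/-- The approximation algorithm for block size `B` and covering family `L`. -/
def algorithm (B : ℕ) (L : List (Finset ℕ × ℕ)) : Program :=
  .seq rankP (.seq initP (.seq (powP B L.length) (nestP (innerP B L) B)))

/-- The exponent `B + 2` counts `B` loops over guessed positions, one over the start of the blocks,
and the linear work per guess. The preparation is at most quadratic and is absorbed. -/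
theorem exists_runs_algorithm {α c β : ℝ} (hα : 1 ≤ α) (hc : 1 ≤ c) (hβ : 1 < β) {B : ℕ}
    (hB : 0 < B) {L : List (Finset ℕ × ℕ)}
    (hL : ∀ K ⊆ range B, ∃ e ∈ L, Covers α β e.1 e.2 K) :
    ∃ K : ℝ, 0 ≤ K ∧ ∀ (n : ℕ) (O : Finset (Fin n) → ℕ → Finset (Fin n)) (w : Fin n → ℕ)
      (F : Set (Finset (Fin n))), IsMonotone F → IsExtensionOracle α w F O →
      Runs O c (algorithm B L) (input w)
        (K * (n + 1 : ℝ) ^ (B + 2) * (L.map fun e => c ^ e.2).sum ^ ((n + B - 1) / B)) fun σ =>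
          output n σ ∈ F ∧ (weight w (output n σ) : ℝ) ≤ β * opt w F := by
  have hLpos : 0 < L.length := by
    obtain ⟨e, he, -⟩ := hL ∅ (empty_subset _)
    exact List.length_pos_of_mem he
  obtain ⟨K₁, hK₁, hsearch⟩ := exists_runs_search hα hc hβ hL
  obtain ⟨K₂, hK₂, hpow⟩ := exists_runs_powP B L.length hB
  -- `57 = 41 + 16`: the ranks and the initial solution.
  refine ⟨57 + K₂ + 19 ^ (B + 1) * K₁, by positivity, fun n O w F hF hO => ?_⟩
  set N := (n + B - 1) / B with hN
  have hN1 : n ≤ N * B := by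
    have h1 := Nat.div_add_mod (n + B - 1) B
    have h2 := Nat.mod_lt (n + B - 1) hB
    rw [← hN] at h1
    rw [mul_comm]; omega
  have hN2 : N ≤ n := by
    rw [hN, ← Nat.lt_succ_iff, Nat.div_lt_iff_lt_mul hB, Nat.succ_mul]
    have : n ≤ n * B := Nat.le_mul_of_pos_right n hB
    omega
  have hu : ∀ i : Fin n, (input w).arr 0 i = w i := fun i => by simp [input]
  have h0 : (input w).reg 0 = n := by simp [input]
  refine (Runs.seq (runs_rankP h0).frame fun σ₁ h1 => Runs.seq (runs_initP (m := n) ?_ ?_).frame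
    fun σ₂ h2 => Runs.seq (hpow n O c σ₂ n ?_ ?_).frame fun σ₃ h3 =>
      hsearch n O w F ((input w).arr 0) N σ₃ hu hF hO hN2 hN1 ?_).mono ?_ fun _ h => h
  · rw [h1.2.reg 0 (by simp [rankP, Program.WritesReg]), h0]
  · rw [h1.2.reg 4 (by simp [rankP, Program.WritesReg])]; simp [input]
  · rw [h2.2.reg 0 (by simp [initP, Program.WritesReg]),
      h1.2.reg 0 (by simp [rankP, Program.WritesReg]), h0]
  · rw [h2.2.reg 5 (by simp [initP, Program.WritesReg]),
      h1.2.reg 5 (by simp [rankP, Program.WritesReg])]; simp [input]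
  · obtain ⟨hrk, ag1⟩ := h1
    obtain ⟨⟨hone, hsum⟩, ag2⟩ := h2
    obtain ⟨⟨h5, h33⟩, ag3⟩ := h3
    have a1 : σ₃.arr 1 = σ₂.arr 1 := ag3.arr 1 (by simp [powP, Program.WritesArr])
    have e0 : σ₁.arr 0 = (input w).arr 0 := ag1.arr 0 (by simp [rankP, Program.WritesArr])
    have huniv : σ₃.getSet n 1 = univ := by
      ext i
      rw [mem_getSet, a1, hone i i.2]
      simp
    refine ⟨?_, h5, ?_, ?_, h33, ?_, ?_⟩
    · rw [ag3.reg 0 (by simp [powP, Program.WritesReg]),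
        ag2.reg 0 (by simp [initP, Program.WritesReg]),
        ag1.reg 0 (by simp [rankP, Program.WritesReg]), h0]
    · rw [ag3.arr 0 (by simp [powP, Program.WritesArr]),
        ag2.arr 0 (by simp [initP, Program.WritesArr]), e0]
    · rw [ag3.arr 2 (by simp [powP, Program.WritesArr]),
        ag2.arr 2 (by simp [initP, Program.WritesArr])]
      exact hrk
    · rw [huniv]; exact hF.univ_mem
    · rw [huniv, ag3.reg 4 (by simp [powP, Program.WritesReg]), hsum, e0, weight,
        ← Fin.sum_univ_eq_sum_range]
      exact sum_congr rfl fun i _ => hu i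
  · set Λ := (L.map fun e => c ^ e.2).sum with hΛ
    have hΛ1 : 1 ≤ Λ ^ N := one_le_pow₀ (le_trans (by exact_mod_cast hLpos)
      (length_le_sum_pow hc L))
    have hn1 : (1 : ℝ) ≤ (n : ℝ) + 1 := by linarith [show (0 : ℝ) ≤ n by positivity]
    have hp2 : ((n : ℝ) + 1) ^ 2 ≤ (n + 1) ^ (B + 2) := pow_le_pow_right₀ hn1 (by omega)
    have hp1 : ((n : ℝ) + 1) ≤ (n + 1) ^ 2 := by nlinarith
    set p := ((n : ℝ) + 1) ^ (B + 2) with hp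
    have hq : p ≤ p * Λ ^ N := le_mul_of_one_le_right (by positivity) hΛ1
    have e : (19 * ((n : ℝ) + 1)) ^ (B + 1) * (K₁ * (n + 1) * Λ ^ N)
        = 19 ^ (B + 1) * K₁ * (p * Λ ^ N) := by rw [hp, mul_pow]; ring
    rw [e]
    have f1 : (28 * ((n : ℝ) + 1) + 13) * (n + 1) ≤ 41 * (p * Λ ^ N) := by nlinarith
    have f2 : 16 * ((n : ℝ) + 1) ≤ 16 * (p * Λ ^ N) := by linarith
    have f3 : K₂ * ((n : ℝ) + 1) ≤ K₂ * (p * Λ ^ N) :=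
      mul_le_mul_of_nonneg_left (by linarith) hK₂
    linarith

end WSM

theorem theorem2 (α c β ε : ℝ) (hα : 1 ≤ α) (hc : 1 ≤ c) (hβ : 1 < β) (hε : 0 < ε) :
    ∃ P : WSM.Program, WSM.IsApproximation α c β P ∧
      ∃ f : ℕ → ℝ, WSM.RunsInTime α c P f ∧
        f =O[Filter.atTop] fun n : ℕ => (WSM.amls α c β + ε) ^ n := by
  -- The other half of `ε` absorbs the polynomial factor, whose degree depends on `B` only.
  obtain ⟨B, hB, L, hL, hcost⟩ := WSM.exists_covering_family hα hc hβ (half_pos hε)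
  obtain ⟨K, hK, hrun⟩ := WSM.exists_runs_algorithm hα hc hβ hB hL
  have hA := WSM.one_le_amls hα hc hβ
  set a := WSM.amls α c β + ε / 2 with ha
  set Λ := (L.map fun e => c ^ e.2).sum with hΛ
  have hΛ0 : 0 ≤ Λ := le_trans (by positivity) (WSM.length_le_sum_pow hc L)
  refine ⟨WSM.algorithm B L, ?_, fun n => K * (n + 1 : ℝ) ^ (B + 2) * Λ ^ ((n + B - 1) / B), ?_, ?_⟩
  · intro n w F hF O hO
    obtain ⟨σ, t, he, -, h⟩ := hrun n O w F hF hO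
    exact ⟨σ, t, he, h⟩
  · intro n w F hF O hO
    obtain ⟨σ, t, he, ht, -⟩ := hrun n O w F hF hO
    exact ⟨σ, t, he, ht⟩
  · have hpoly : (fun n : ℕ => (n : ℝ) ^ (B + 2) * a ^ n)
        =O[Filter.atTop] fun n : ℕ => (WSM.amls α c β + ε) ^ n :=
      (isLittleO_pow_const_mul_const_pow_const_pow_of_norm_lt (B + 2)
        (by rw [Real.norm_of_nonneg (by linarith)]; linarith)).isBigO
    refine Asymptotics.IsBigO.trans (Asymptotics.IsBigO.of_bound (K * 2 ^ (B + 2) * a ^ B) ?_) hpoly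
    filter_upwards [Filter.eventually_ge_atTop 1] with n hn
    have hn' : (1 : ℝ) ≤ n := by exact_mod_cast hn
    have ha1 : 1 ≤ a := by linarith
    rw [Real.norm_of_nonneg (by positivity), Real.norm_of_nonneg (by positivity)]
    have h1 : ((n : ℝ) + 1) ^ (B + 2) ≤ 2 ^ (B + 2) * n ^ (B + 2) := by
      rw [← mul_pow]; gcongr; linarith
    -- Rounding up the number of blocks adds fewer than `B` positions, which costs at most the
    -- constant factor `a ^ B`.
    have h2 : Λ ^ ((n + B - 1) / B) ≤ a ^ B * a ^ n := by
      calc Λ ^ ((n + B - 1) / B) ≤ (a ^ B) ^ ((n + B - 1) / B) := by gcongr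
        _ = a ^ (B * ((n + B - 1) / B)) := (pow_mul _ _ _).symm
        _ ≤ a ^ (B + n) := pow_le_pow_right₀ ha1
            ((Nat.mul_div_le _ _).trans (by omega))
        _ = _ := pow_add _ _ _
    calc K * ((n : ℝ) + 1) ^ (B + 2) * Λ ^ ((n + B - 1) / B)
        ≤ K * (2 ^ (B + 2) * n ^ (B + 2)) * (a ^ B * a ^ n) := by gcongr
      _ = _ := by ring
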